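/- There exist absolute constants $c,c'>0$ such that the following holds. Let $d\ge 0$, let $\|\cdot\|$ be a norm on $\mathbb{R}^d$, and let $\mathcal{B}^\circ=\{t\in\mathbb{R}^d:\langle t,x\rangle\le 1 \text{ whenever } \|x\|\le 1\}$ be the unit ball of the dual norm, with set of extreme points $T$. Let $\delta\in(0,1)$, put $n=\lceil\log(2/\delta)\rceil$, let $N\ge n$, and put $m=\lfloor N/n\rfloor$. For a sample $x=(x_1,\dots,x_N)\in(\mathbb{R}^d)^N$ let $Z_j=\frac1m\sum_{i=(j-1)m+1}^{jm}x_i$, $1\le j\le n$, be the means of $n$ consecutive blocks of length $m$ (the remaining $N-nm$ points are not used). For real $\epsilon$ let $$\mathbb{S}(\epsilon)=\bigcap_{t\in T}\Big\{y\in\mathbb{R}^d:\ |\langle t,Z_j\rangle-\langle t,y\rangle|\le\epsilon\ \text{ for more than } n/2 \text{ indices } j\Big\},\qquad \epsilon_0=\inf\{\epsilon>0:\mathbb{S}(\epsilon)\ne\emptyset\}.$$ (a) For every sample $x$, the set $\{\epsilon>0:\mathbb{S}(\epsilon)\neq\emptyset\}$ is nonempty; the sets $\mathbb{S}(\epsilon)$,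 $\epsilon>\epsilon_0$, are nonempty, compact and nested (increasing in $\epsilon$); and $\bigcap_{\epsilon>\epsilon_0}\mathbb{S}(\epsilon)\ne\emptyset$. (b) Let $\widetilde\mu_N=\widetilde\mu_N(x_1,\dots,x_N)$ be an arbitrary point of $\bigcap_{\epsilon>\epsilon_0}\mathbb{S}(\epsilon)$, chosen for each sample; the choice involves neither a prescribed accuracy nor the distribution of the data. Let $X$ be any random vector in $\mathbb{R}^d$ with $\mathbb{E}|X|^2<\infty$ ($|\cdot|$ the Euclidean norm), mean $\mu$ and covariance matrix $\Sigma$, and let $X_1,\dots,X_N$ be independent copies of $X$. Let $Y_N=N^{-1/2}\sum_{i=1}^N\varepsilon_i(X_i-\mu)$, where $\varepsilon_1,\dots,\varepsilon_N$ are independent symmetric $\{-1,1\}$-valued random variables independent of $(X_i)$; let $G$ be a centred Gaussian vector with covariance matrix $\Sigma$; and let $R=\sup_{t\in\mathcal{B}^\circ}\big(\mathbb{E}\langle t,X-\mu\rangle^2\big)^{1/2}$. If $$\epsilon\ \ge\ \frac{c}{\sqrt N}\,\max\Big\{\mathbb{E}\|Y_N\|,\ \ \mathbb{E}\|G\|+R\sqrt{\log(2/\delta)}\Big\},$$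 then, with probability at least $1-c'\delta$, $$\|\widetilde\mu_N(X_1,\dots,X_N)-\mu\|\le\epsilon .$$ -/

import Mathlib

open MeasureTheory ProbabilityTheory
open scoped RealInnerProductSpace

namespace NormMean

/-- The space `ℝ^d`, with its standard inner product. -/
abbrev Vec (d : ℕ) := EuclideanSpace ℝ (Fin d)

/-- The unit ball of the dual of `(ℝ^d, p)`; linear functionals are identified with points of
`ℝ^d` through the standard inner product. -/
def dualBall {d : ℕ} (p : Seminorm ℝ (Vec d)) : Set (Vec d) :=
  {t | ∀ x : Vec d, p x ≤ 1 → ⟪t, x⟫ ≤ 1}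

/-! ### Parameters of a distribution `ν` on `ℝ^d` -/

/-- The mean vector. -/
noncomputable def mean {d : ℕ} (ν : Measure (Vec d)) : Vec d :=
  ∫ x, x ∂ν

/-- The covariance matrix. -/
noncomputable def covMat {d : ℕ} (ν : Measure (Vec d)) : Matrix (Fin d) (Fin d) ℝ :=
  Matrix.of fun i j => cov[fun x : Vec d => x i, fun x : Vec d => x j; ν]

/-- `E p(Y_N)` where `Y_N = N^{-1/2} ∑ s_i (X_i - mean)`, the vectors `X_1, …, X_N` are
independent with law `ν`, and the sign vector `s` is independent of them and uniform on
`{-1, 1}^N`. The expectation over `s` is written as an average over the `2^N` sign vectors. -/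
noncomputable def rademacherMean {d : ℕ} (p : Seminorm ℝ (Vec d)) (N : ℕ)
    (ν : Measure (Vec d)) : ℝ :=
  (2 ^ N : ℝ)⁻¹ * ∑ s : Fin N → ℤˣ,
    ∫ x : Fin N → Vec d,
      p ((Real.sqrt N)⁻¹ • ∑ i, (((s i : ℤˣ) : ℤ) : ℝ) • (x i - mean ν))
      ∂(Measure.pi fun _ : Fin N => ν)

/-- `E p(G)` where `G` is the centred Gaussian vector with the same covariance matrix as `ν`. -/
noncomputable def gaussianMean {d : ℕ} (p : Seminorm ℝ (Vec d)) (ν : Measure (Vec d)) : ℝ :=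
  ∫ g, p g ∂(multivariateGaussian (0 : Vec d) (covMat ν))

/-- `R = sup (E ⟨t, X - mean⟩²)^{1/2}`, over `t` in the dual unit ball. -/
noncomputable def weakStd {d : ℕ} (p : Seminorm ℝ (Vec d)) (ν : Measure (Vec d)) : ℝ :=
  ⨆ t : dualBall p, Real.sqrt (∫ x, ⟪(t : Vec d), x - mean ν⟫ ^ 2 ∂ν)

/-! ### The estimator -/

/-- The number of blocks, `n = ⌈log (2 / δ)⌉`. -/
noncomputable def numBlocks (δ : ℝ) : ℕ := ⌈Real.log (2 / δ)⌉₊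

/-- The indices of the `j`-th of `n` consecutive blocks of length `⌊N / n⌋` in `{0, …, N - 1}`;
the `N - n ⌊N / n⌋` last indices are in no block. -/
def block (n N : ℕ) (j : Fin n) : Finset (Fin N) :=
  {i : Fin N | (j : ℕ) * (N / n) ≤ (i : ℕ) ∧ (i : ℕ) < ((j : ℕ) + 1) * (N / n)}

/-- The empirical mean `Z_j` of the `j`-th block. -/
noncomputable def blockMean {d N : ℕ} (n : ℕ) (x : Fin N → Vec d) (j : Fin n) : Vec d :=
  ((N / n : ℕ) : ℝ)⁻¹ • ∑ i ∈ block n N j, x i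

/-- The set of those `y` such that `|⟨t, Z_j⟩ - ⟨t, y⟩| ≤ ε` for more than `n / 2` blocks `j`. -/
def slabUnion {d N : ℕ} (n : ℕ) (x : Fin N → Vec d) (ε : ℝ) (t : Vec d) : Set (Vec d) :=
  {y | (n : ℝ) / 2 <
    (({j : Fin n | |⟪t, blockMean n x j⟫ - ⟪t, y⟫| ≤ ε} : Set (Fin n)).ncard : ℝ)}

/-- The set `S(ε)` computed from the sample `x` at confidence level `δ`: the intersection of the
sets `slabUnion` over all extreme points of the dual unit ball. -/
def feasible {d N : ℕ} (p : Seminorm ℝ (Vec d)) (δ : ℝ) (x : Fin N → Vec d) (ε : ℝ) :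
    Set (Vec d) :=
  ⋂ t ∈ Set.extremePoints ℝ (dualBall p), slabUnion (numBlocks δ) x ε t

/-- `ε₀ = inf {ε > 0 : S(ε) ≠ ∅}`. -/
noncomputable def epsZero {d N : ℕ} (p : Seminorm ℝ (Vec d)) (δ : ℝ) (x : Fin N → Vec d) : ℝ :=
  sInf {ε : ℝ | 0 < ε ∧ (feasible p δ x ε).Nonempty}

/-- The intersection of the sets `S(ε)` over all `ε > ε₀`. -/
def estimateSet {d N : ℕ} (p : Seminorm ℝ (Vec d)) (δ : ℝ) (x : Fin N → Vec d) : Set (Vec d) :=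
  ⋂ ε ∈ Set.Ioi (epsZero p δ x), feasible p δ x ε

end NormMean

namespace NormMean

/-! Call a direction `t` in `T` bad at level `s` if at least half of the blocks satisfy |⟨t, Z_j -
μ⟩| > `s`. Everything reduces to one event: no direction is bad at any level above `ε / 2`. On it μ
is feasible at all these levels, so ε₀ ≤ `ε / 2`, and any point of `estimateSet` is feasible at
every level above `ε / 2`. Two majorities of blocks share a block, so this point and μ differ by at
most `ε` along every extreme `t`; by Krein–Milman and Hahn–Banach the extreme points determine the
norm.

The probability of the event is controlled through `maxCount`, the largest number of blocks outside
a slab, over finitely many directions. Its mean is small (`integral_maxOver_trunc_le`): indicators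
are dominated by the Lipschitz function `trunc`, symmetrization and contraction bound the
fluctuation by E‖Y_N‖, and the individual means are bounded by the weak variance R. Concentration
then comes from Talagrand's control by several points (`integral_mul_prod_integral_le_one`), since
`maxCount` is subadditive in the sense of `maxCount_le_sum_add`: a mean of at most n/256 forces a
probability of order exp(-n), hence of order δ, for reaching n/2
(`measureReal_half_le_maxCount_le`). The bound does not depend on the number of directions, and
openness of the bad events extends it to all of `T` (`measure_biUnion_le_of_forall_fin`). -/

/-! ### Talagrand's control by q points -/

/-- Since (q - w)(w - 1) ≥ 0, one has w + q/w ≤ q + 1. Integrate this and apply v ≤ exp(v - 1) to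
both factors: the exponents add up to at most 0. -/
lemma integral_mul_integral_inv_pow_le_one {E : Type*} [MeasurableSpace E] (μ : Measure E)
    [IsProbabilityMeasure μ] (q : ℕ) (w : E → ℝ) (hw : Measurable w)
    (h1 : ∀ a, 1 ≤ w a) (hq : ∀ a, w a ≤ q) :
    (∫ a, w a ∂μ) * (∫ a, (w a)⁻¹ ∂μ) ^ q ≤ 1 := by
  have iw : Integrable w μ := Integrable.of_bound hw.aestronglyMeasurable q
    (.of_forall fun a => by
      rw [Real.norm_eq_abs, abs_of_nonneg (by linarith [h1 a])]; exact hq a)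
  have ii : Integrable (fun a => (w a)⁻¹) μ :=
    Integrable.of_bound hw.inv.aestronglyMeasurable 1 (.of_forall fun a => by
      rw [Real.norm_eq_abs, abs_of_nonneg (inv_nonneg.2 (by linarith [h1 a]))]
      exact inv_le_one_of_one_le₀ (h1 a))
  have e1 : ∫ a, w a ∂μ ≤ Real.exp (∫ a, w a ∂μ - 1) := by
    linarith [Real.add_one_le_exp (∫ a, w a ∂μ - 1)]
  have e2 : (∫ a, (w a)⁻¹ ∂μ) ^ q ≤ Real.exp (q * (∫ a, (w a)⁻¹ ∂μ - 1)) := by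
    rw [Real.exp_nat_mul]
    refine pow_le_pow_left₀ (integral_nonneg fun a => inv_nonneg.2 (by linarith [h1 a])) ?_ _
    linarith [Real.add_one_le_exp (∫ a, (w a)⁻¹ ∂μ - 1)]
  have e3 : ∫ a, (w a + q * (w a)⁻¹) ∂μ ≤ ∫ _, ((q : ℝ) + 1) ∂μ := by
    refine integral_mono (iw.add (ii.const_mul _)) (integrable_const _) fun a => ?_
    have := h1 a
    have h2 := hq a
    have hp : 0 < w a := by linarith
    have : (q : ℝ) + 1 - (w a + q * (w a)⁻¹) = (q - w a) * (w a - 1) * (w a)⁻¹ := by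
      field_simp; ring
    have h3 : 0 ≤ (q - w a) * (w a - 1) * (w a)⁻¹ := by
      apply mul_nonneg (mul_nonneg _ _) (inv_nonneg.2 hp.le) <;> linarith
    show w a + q * (w a)⁻¹ ≤ q + 1
    linarith
  rw [integral_add iw (ii.const_mul _), integral_const_mul] at e3
  simp only [integral_const, probReal_univ, one_smul] at e3
  calc _ ≤ Real.exp (∫ a, w a ∂μ - 1) * Real.exp (q * (∫ a, (w a)⁻¹ ∂μ - 1)) := by
        gcongr
        exact pow_nonneg (integral_nonneg fun a => inv_nonneg.2 (by linarith [h1 a])) _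
    _ = Real.exp (∫ a, w a ∂μ - 1 + q * (∫ a, (w a)⁻¹ ∂μ - 1)) := (Real.exp_add _ _).symm
    _ ≤ 1 := Real.exp_le_one_iff.2 (by linarith)

/-- The one-dimensional case of the control by several points. -/
lemma integral_mul_prod_integral_le_one_of_forall {E : Type*} [MeasurableSpace E]
    (μ : Measure E) [IsProbabilityMeasure μ] (q : ℕ) (hq1 : 1 ≤ q) (U : E → ℝ)
    (G : Fin q → E → ℝ) (hU : Measurable U) (hG : ∀ l, Measurable (G l)) (hU0 : ∀ a, 0 ≤ U a)
    {C : ℝ} (hUC : ∀ a, U a ≤ C)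
    (hG0 : ∀ l a, 0 ≤ G l a) (hG1 : ∀ l a, G l a ≤ 1)
    (h : ∀ (a : E) (b : Fin q → E), U a * ∏ l, G l (b l) ≤ q)
    (h' : ∀ (a : E) (b : Fin q → E), (∃ l, a = b l) → U a * ∏ l, G l (b l) ≤ 1) :
    (∫ a, U a ∂μ) * ∏ l, ∫ a, G l a ∂μ ≤ 1 := by
  have : Nonempty E := nonempty_of_isProbabilityMeasure μ
  -- Letting each `b l` approach the supremum of `G l` gives `B1`; doing so for all indices but one,
  -- where the point `a` itself is used, gives `B2`.
  set M : Fin q → ℝ := fun l => sSup (Set.range (G l)) with hM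
  have bdd : ∀ l, BddAbove (Set.range (G l)) := fun l => ⟨1, by rintro _ ⟨a, rfl⟩; exact hG1 l a⟩
  have hGM : ∀ l a, G l a ≤ M l := fun l a => le_csSup (bdd l) ⟨a, rfl⟩
  have hM0 : ∀ l, 0 ≤ M l := fun l => (hG0 l (Classical.arbitrary E)).trans (hGM l _)
  by_cases hz : ∃ l, M l = 0
  · obtain ⟨l, hl⟩ := hz
    have : ∫ a, G l a ∂μ = 0 := by
      have : G l = 0 := funext fun a => le_antisymm ((hGM l a).trans_eq hl) (hG0 l a)
      simp [this]
    rw [Finset.prod_eq_zero (Finset.mem_univ l) this]; simp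
  push Not at hz
  have hMp : ∀ l, 0 < M l := fun l => lt_of_le_of_ne (hM0 l) (hz l).symm
  have seq : ∀ l, ∃ b : ℕ → E, Filter.Tendsto (fun k => G l (b k)) Filter.atTop (nhds (M l)) := by
    intro l
    obtain ⟨v, -, hv, hv'⟩ := exists_seq_tendsto_sSup (Set.range_nonempty (G l)) (bdd l)
    choose b hb using hv'
    exact ⟨b, by simpa only [hb] using hv⟩
  choose b hb using seq
  have B1 : ∀ a, U a * ∏ l, M l ≤ q := fun a =>
    le_of_tendsto' ((tendsto_finsetProd _ fun l _ => hb l).const_mul (U a))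
      fun k => h a fun l => b l k
  have B2 : ∀ a i, U a * (∏ l, M l) * (G i a / M i) ≤ 1 := by
    intro a i
    have : U a * ∏ l, Function.update M i (G i a) l ≤ 1 := by
      refine le_of_tendsto' (x := Filter.atTop) ((tendsto_finsetProd (f := fun l k =>
        G l (Function.update (fun l => b l k) i a l)) _ fun l _ => ?_).const_mul (U a))
        fun k => h' a _ ⟨i, by simp⟩
      by_cases hl : l = i
      · subst hl; simp
      · simpa [Function.update_of_ne hl] using hb l
    rw [Finset.prod_update_of_mem (Finset.mem_univ i)] at this
    rw [← Finset.mul_prod_erase Finset.univ M (Finset.mem_univ i)]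
    rw [Finset.sdiff_singleton_eq_erase] at this
    have hi := hMp i
    calc _ = U a * (G i a * ∏ x ∈ Finset.univ.erase i, M x) := by field_simp
      _ ≤ 1 := this
  set PM := ∏ l, M l with hPM
  have PM0 : 0 < PM := Finset.prod_pos fun l _ => hMp l
  -- `B2` says that `G l` ≤ `M l` / w where w exceeds 1, so one function w in [1, q] controls `U`
  -- and all the `G l` at once.
  set w : E → ℝ := fun a => max (U a * PM) 1 with hw
  have w1 : ∀ a, 1 ≤ w a := fun a => le_max_right _ _
  have wq : ∀ a, w a ≤ q := fun a => max_le (B1 a) (by exact_mod_cast hq1)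
  have wm : Measurable w := (hU.mul_const _).max measurable_const
  have key := integral_mul_integral_inv_pow_le_one μ q w wm w1 wq
  have iw : Integrable w μ := Integrable.of_bound wm.aestronglyMeasurable q
    (.of_forall fun a => by
      rw [Real.norm_eq_abs, abs_of_nonneg (by linarith [w1 a])]; exact wq a)
  have ii : Integrable (fun a => (w a)⁻¹) μ :=
    Integrable.of_bound wm.inv.aestronglyMeasurable 1 (.of_forall fun a => by
      rw [Real.norm_eq_abs, abs_of_nonneg (inv_nonneg.2 (by linarith [w1 a]))]
      exact inv_le_one_of_one_le₀ (w1 a))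
  have iU : Integrable U μ := Integrable.of_bound hU.aestronglyMeasurable C
    (.of_forall fun a => by rw [Real.norm_eq_abs, abs_of_nonneg (hU0 a)]; exact hUC a)
  have iG : ∀ l, Integrable (G l) μ := fun l => Integrable.of_bound (hG l).aestronglyMeasurable 1
    (.of_forall fun a => by rw [Real.norm_eq_abs, abs_of_nonneg (hG0 l a)]; exact hG1 l a)
  have g1 : ∀ l, ∫ a, G l a ∂μ ≤ M l * ∫ a, (w a)⁻¹ ∂μ := by
    intro l
    rw [← integral_const_mul]
    refine integral_mono (iG l) (ii.const_mul _) fun a => ?_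
    show G l a ≤ M l * (w a)⁻¹
    have hp : 0 < w a := by linarith [w1 a]
    rw [← div_eq_mul_inv, le_div_iff₀ hp]
    rcases max_cases (U a * PM) 1 with ⟨e, -⟩ | ⟨e, -⟩
    · have := B2 a l
      rw [← mul_div_assoc, div_le_one (hMp l)] at this
      show G l a * max _ _ ≤ _
      rw [e]; linarith
    · show G l a * max _ _ ≤ _
      rw [e, mul_one]; exact hGM l a
  calc (∫ a, U a ∂μ) * ∏ l, ∫ a, G l a ∂μ
      ≤ (∫ a, U a ∂μ) * ∏ l, (M l * ∫ a, (w a)⁻¹ ∂μ) := by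
        refine mul_le_mul_of_nonneg_left (Finset.prod_le_prod (fun l _ => integral_nonneg (hG0 l))
          fun l _ => g1 l) (integral_nonneg hU0)
    _ = (∫ a, U a * PM ∂μ) * (∫ a, (w a)⁻¹ ∂μ) ^ q := by
        rw [Finset.prod_mul_distrib, integral_mul_const]; simp; ring
    _ ≤ (∫ a, w a ∂μ) * (∫ a, (w a)⁻¹ ∂μ) ^ q := by
        refine mul_le_mul_of_nonneg_right (integral_mono (iU.mul_const _) iw fun a =>
          le_max_left _ _) (pow_nonneg (integral_nonneg fun a =>
            inv_nonneg.2 (by linarith [w1 a])) _)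
    _ ≤ 1 := key

lemma integral_pi_succ {E : Type*} [MeasurableSpace E] {n : ℕ} (μ : Fin (n + 1) → Measure E)
    [∀ i, IsProbabilityMeasure (μ i)] (u : (Fin (n + 1) → E) → ℝ) (hu : Measurable u) {C : ℝ}
    (hC : ∀ x, ‖u x‖ ≤ C) :
    ∫ x, u x ∂Measure.pi μ
      = ∫ a, ∫ y, u (Fin.cons a y) ∂Measure.pi (fun j => μ j.succ) ∂μ 0 := by
  have mp := (measurePreserving_piFinSuccAbove μ 0).symm
  rw [← mp.integral_comp (MeasurableEquiv.measurableEmbedding _)]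
  rw [integral_prod]
  · simp [MeasurableEquiv.piFinSuccAbove, Fin.zero_succAbove]
    rfl
  · refine Integrable.of_bound ?_ C (.of_forall fun x => hC _)
    exact (hu.comp (MeasurableEquiv.measurable _)).aestronglyMeasurable

/-- Control by `q` points, in functional form (Talagrand). -/
theorem integral_mul_prod_integral_le_one {E : Type*} [MeasurableSpace E] (q : ℕ) (hq : 1 ≤ q) :
    ∀ (n : ℕ) (μ : Fin n → Measure E) [∀ i, IsProbabilityMeasure (μ i)]
      (u : (Fin n → E) → ℝ) (g : Fin q → (Fin n → E) → ℝ) (C : ℝ),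
      Measurable u → (∀ l, Measurable (g l)) → (∀ x, 0 ≤ u x) → (∀ x, u x ≤ C) →
      (∀ l x, 0 ≤ g l x) → (∀ l x, g l x ≤ 1) →
      (∀ (x : Fin n → E) (y : Fin q → Fin n → E), u x * ∏ l, g l (y l) ≤ (q : ℝ) ^ ({j | ∀ l, x j ≠ y l j} : Set (Fin n)).ncard) →
      (∫ x, u x ∂Measure.pi μ) * ∏ l, ∫ x, g l x ∂Measure.pi μ ≤ 1 := by
  intro n
  induction n with
  | zero =>
    intro μ _ u g C _ _ _ _ _ _ h
    have e : ∀ v : (Fin 0 → E) → ℝ, ∫ x, v x ∂Measure.pi μ = v default := fun v => by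
      rw [Measure.pi_of_empty μ default, integral_dirac]
    simp only [e]
    refine (h default fun _ => default).trans ?_
    simp [Set.eq_empty_of_isEmpty]
  | succ n ih =>
    intro μ _ u g C hu hg hu0 hC hg0 hg1 h
    have cm : Measurable fun z : E × (Fin n → E) => (Fin.cons z.1 z.2 : Fin (n + 1) → E) := by
      refine measurable_pi_lambda _ fun j => ?_
      refine Fin.cases ?_ (fun j => ?_) j
      · simpa using measurable_fst
      · simp only [Fin.cons_succ]; fun_prop
    have cm' : ∀ a : E, Measurable fun y : Fin n → E => (Fin.cons a y : Fin (n + 1) → E) :=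
      fun a => cm.comp measurable_prodMk_left
    have bu : ∀ x, ‖u x‖ ≤ C := fun x => by
      rw [Real.norm_eq_abs, abs_of_nonneg (hu0 x)]; exact hC x
    have bg : ∀ l x, ‖g l x‖ ≤ 1 := fun l x => by
      rw [Real.norm_eq_abs, abs_of_nonneg (hg0 l x)]; exact hg1 l x
    rw [integral_pi_succ μ u hu bu]
    simp_rw [fun l => integral_pi_succ μ (g l) (hg l) (bg l)]
    -- The induction hypothesis applies to the sections at fixed first coordinates, after scaling by
    -- `K`. A factor `K` = q is lost only if `a` differs from every `b l`; otherwise `K` = 1. These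
    -- are the two hypotheses of the one-dimensional case.
    have main : ∀ (a : E) (b : Fin q → E) (K : ℝ), 0 < K →
        (∀ (x : Fin n → E) (y : Fin q → Fin n → E), u (Fin.cons a x) * ∏ l, g l (Fin.cons (b l) (y l)) ≤
          K * (q : ℝ) ^ ({j | ∀ l, x j ≠ y l j} : Set (Fin n)).ncard) →
        (∫ y, u (Fin.cons a y) ∂Measure.pi (fun j => μ j.succ)) *
          ∏ l, ∫ y, g l (Fin.cons (b l) y) ∂Measure.pi (fun j => μ j.succ) ≤ K := by
      intro a b K hK hh
      have := ih (fun j => μ j.succ) (fun x => K⁻¹ * u (Fin.cons a x))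
        (fun l x => g l (Fin.cons (b l) x)) (K⁻¹ * C) ((hu.comp (cm' a)).const_mul _)
        (fun l => (hg l).comp (cm' _)) (fun x => mul_nonneg (inv_nonneg.2 hK.le) (hu0 _))
        (fun x => mul_le_mul_of_nonneg_left (hC _) (inv_nonneg.2 hK.le))
        (fun l x => hg0 _ _) (fun l x => hg1 _ _) (fun x y => by
          rw [mul_assoc, inv_mul_le_iff₀ hK]; exact hh x y)
      rwa [integral_const_mul, mul_assoc, inv_mul_le_iff₀ hK, mul_one] at this
    have ncs : ∀ (a : E) (b : Fin q → E) (x : Fin n → E) (y : Fin q → Fin n → E),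
        ({j | ∀ l, (Fin.cons a x : Fin (n + 1) → E) j
          ≠ (Fin.cons (b l) (y l) : Fin (n + 1) → E) j} : Set (Fin (n + 1))) ⊆
          {0} ∪ Fin.succ '' {j | ∀ l, x j ≠ y l j} := by
      intro a b x y j
      refine Fin.cases ?_ (fun j => ?_) j
      · simp
      · intro hj
        exact Or.inr ⟨j, by simpa using hj, rfl⟩
    have q1 : (1 : ℝ) ≤ q := by exact_mod_cast hq
    refine integral_mul_prod_integral_le_one_of_forall (μ 0) q hq
      (fun a => ∫ y, u (Fin.cons a y) ∂Measure.pi (fun j => μ j.succ))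
      (fun l a => ∫ y, g l (Fin.cons a y) ∂Measure.pi (fun j => μ j.succ))
      (C := C) ?_ ?_ ?_ ?_ ?_ ?_ ?_ ?_
    · exact ((hu.comp cm).stronglyMeasurable.integral_prod_right').measurable
    · exact fun l => (((hg l).comp cm).stronglyMeasurable.integral_prod_right').measurable
    · exact fun a => integral_nonneg fun y => hu0 _
    · intro a
      have : ‖∫ y, u (Fin.cons a y) ∂Measure.pi (fun j => μ j.succ)‖ ≤ C := by
        simpa using norm_integral_le_of_norm_le_const (μ := Measure.pi (fun j => μ j.succ))
          (f := fun y => u (Fin.cons a y)) (.of_forall fun y => bu _)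
      exact (le_abs_self _).trans this
    · exact fun l a => integral_nonneg fun y => hg0 _ _
    · intro l a
      have : ‖∫ y, g l (Fin.cons a y) ∂Measure.pi (fun j => μ j.succ)‖ ≤ 1 := by
        simpa using norm_integral_le_of_norm_le_const (μ := Measure.pi (fun j => μ j.succ))
          (f := fun y => g l (Fin.cons a y)) (.of_forall fun y => bg l _)
      exact (le_abs_self _).trans this
    · intro a b
      refine main a b q (by linarith) fun x y => (h _ _).trans ?_
      rw [← pow_succ']
      refine pow_le_pow_right₀ q1 ?_
      refine (Set.ncard_le_ncard (ncs a b x y) (Set.toFinite _)).trans ?_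
      refine (Set.ncard_union_le _ _).trans ?_
      rw [Set.ncard_image_of_injective _ (Fin.succ_injective n), Set.ncard_singleton, add_comm]
    · rintro a b ⟨l0, hl0⟩
      refine main a b 1 one_pos fun x y => (h _ _).trans ?_
      rw [one_mul]
      refine pow_le_pow_right₀ q1 ?_
      rw [← Set.ncard_image_of_injective _ (Fin.succ_injective n)]
      refine Set.ncard_le_ncard (fun j hj => ?_) (Set.toFinite _)
      rcases ncs a b x y hj with hj' | hj'
      · rw [Set.mem_singleton_iff] at hj'
        subst hj'
        exact absurd hl0 (by simpa using hj l0)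
      · exact hj'

/-- Functions measurable with respect to disjoint groups of independent variables are
independent. -/
lemma iIndepFun_of_measurable_iSup {Ω ι κ E F : Type*} {mΩ : MeasurableSpace Ω}
    [mE : MeasurableSpace E] [mF : MeasurableSpace F] {P : Measure Ω} [IsProbabilityMeasure P]
    {f : ι → Ω → E} (hf : iIndepFun f P) (hfm : ∀ i, Measurable (f i)) (S : κ → Set ι)
    (hS : Pairwise fun j k => Disjoint (S j) (S k)) {W : κ → Ω → F}
    (hW : ∀ j, Measurable[⨆ i ∈ S j, mE.comap (f i)] (W j)) : iIndepFun W P := by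
  classical
  rw [iIndepFun_iff_measure_inter_preimage_eq_mul]
  intro s T hT
  induction s using Finset.induction_on with
  | empty => simp
  | insert k s hk ih =>
    have ih' := ih fun i hi => hT i (Finset.mem_insert_of_mem hi)
    rw [Finset.prod_insert hk, ← ih', Finset.set_biInter_insert]
    have hind : Indep (⨆ i ∈ S k, mE.comap (f i)) (⨆ i ∈ ⋃ j ∈ s, S j, mE.comap (f i)) P := by
      refine indep_iSup_of_disjoint (fun i => (hfm i).comap_le) hf.iIndep ?_
      simp only [Set.disjoint_iUnion_right]
      intro j hj
      exact hS (fun h => hk (h ▸ hj))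
    refine (Indep_iff _ _ _).1 hind _ _ ?_ ?_
    · exact hW k (hT k (Finset.mem_insert_self _ _))
    · refine Finset.measurableSet_biInter _ fun j hj => ?_
      refine (?_ : (⨆ i ∈ S j, mE.comap (f i)) ≤ _) _ (hW j (hT j (Finset.mem_insert_of_mem hj)))
      refine iSup₂_le fun i hi => ?_
      refine le_iSup₂_of_le i ?_ le_rfl
      exact Set.mem_biUnion (Finset.mem_coe.2 hj) hi

/-! ### Symmetrization for sublinear functionals of independent centred vectors -/

section Symmetrization

variable {E : Type*} [NormedAddCommGroup E] [NormedSpace ℝ E]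

/-- A continuous sublinear functional. -/
structure IsSublinear (q : E → ℝ) : Prop where
  add_le : ∀ x y, q (x + y) ≤ q x + q y
  smul_eq : ∀ (c : ℝ) x, 0 ≤ c → q (c • x) = c * q x
  continuous : Continuous q
  bound : ∃ C, ∀ x, ‖q x‖ ≤ C * ‖x‖

lemma IsSublinear.convexOn {q : E → ℝ} (hq : IsSublinear q) : ConvexOn ℝ Set.univ q := by
  refine ⟨convex_univ, fun x _ y _ a b ha hb _ => ?_⟩
  refine (hq.add_le _ _).trans ?_
  rw [hq.smul_eq _ _ ha, hq.smul_eq _ _ hb]; rfl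

lemma IsSublinear.integrable {q : E → ℝ} (hq : IsSublinear q) {Ω : Type*} [MeasurableSpace Ω]
    {P : Measure Ω} {U : Ω → E} (hU : Integrable U P) : Integrable (fun ω => q (U ω)) P := by
  obtain ⟨C, hC⟩ := hq.bound
  refine (hU.norm.const_mul C).mono' (hq.continuous.comp_aestronglyMeasurable hU.1)
    (.of_forall fun ω => hC _)

variable [FiniteDimensional ℝ E] [MeasurableSpace E] [BorelSpace E]
  {Ω : Type*} [MeasurableSpace Ω] {P : Measure Ω} [IsProbabilityMeasure P] {q : E → ℝ}

/-- Jensen's inequality in V at fixed U = u: q(u) = q(E(u + V)) ≤ E q(u + V). -/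
lemma IsSublinear.integral_le_integral_add (hq : IsSublinear q) {U V : Ω → E}
    (hU : Integrable U P) (hV : Integrable V P) (hUm : Measurable U) (hVm : Measurable V)
    (hind : IndepFun U V P) (hV0 : ∫ ω, V ω ∂P = 0) :
    ∫ ω, q (U ω) ∂P ≤ ∫ ω, q (U ω + V ω) ∂P := by
  have : ProperSpace E := FiniteDimensional.proper ℝ E
  have pU := Measure.isProbabilityMeasure_map (μ := P) hUm.aemeasurable
  have pV := Measure.isProbabilityMeasure_map (μ := P) hVm.aemeasurable
  have hmap := (indepFun_iff_map_prod_eq_prod_map_map hUm.aemeasurable hVm.aemeasurable).1 hind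
  have hc : Continuous fun z : E × E => q (z.1 + z.2) := hq.continuous.comp (by fun_prop)
  have hint : Integrable (fun z : E × E => q (z.1 + z.2))
      ((P.map U).prod (P.map V)) := by
    rw [← hmap, integrable_map_measure hc.aestronglyMeasurable (hUm.prodMk hVm).aemeasurable]
    exact hq.integrable (hU.add hV)
  have e1 : ∫ ω, q (U ω + V ω) ∂P = ∫ u, ∫ v, q (u + v) ∂(P.map V) ∂(P.map U) := by
    rw [← integral_prod _ hint, ← hmap,
      integral_map (hUm.prodMk hVm).aemeasurable hc.aestronglyMeasurable]
  have e2 : ∫ ω, q (U ω) ∂P = ∫ u, q u ∂(P.map U) :=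
    (integral_map hUm.aemeasurable hq.continuous.aestronglyMeasurable).symm
  rw [e1, e2]
  have iV : Integrable (fun v : E => v) (P.map V) := by
    exact (integrable_map_measure aestronglyMeasurable_id hVm.aemeasurable).2 hV
  have mV : ∫ v, v ∂(P.map V) = 0 := by
    exact (integral_map hVm.aemeasurable aestronglyMeasurable_id).trans hV0
  refine integral_mono ?_ hint.integral_prod_left fun u => ?_
  · rw [integrable_map_measure hq.continuous.aestronglyMeasurable hUm.aemeasurable]
    exact hq.integrable hU
  · have iu : Integrable (fun v : E => u + v) (P.map V) := (integrable_const u).add iV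
    have := hq.convexOn.map_integral_le hq.continuous.continuousOn isClosed_univ
      (.of_forall fun _ => Set.mem_univ _) iu (hq.integrable iu)
    rwa [integral_add (integrable_const u) iV, mV, integral_const, probReal_univ, one_smul,
      add_zero] at this

variable {κ : Type*} [Fintype κ] {ξ : κ → Ω → E}

/-- The discarded terms form a centred vector independent of those kept. -/
lemma IsSublinear.integral_sum_le_integral_sum (hq : IsSublinear q) (hξ : ∀ i, Integrable (ξ i) P)
    (hξm : ∀ i, Measurable (ξ i)) (hind : iIndepFun ξ P) (h0 : ∀ i, ∫ ω, ξ i ω ∂P = 0)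
    (a : κ → ℝ) (I : Finset κ) :
    ∫ ω, q (∑ i ∈ I, a i • ξ i ω) ∂P ≤ ∫ ω, q (∑ i, a i • ξ i ω) ∂P := by
  classical
  have : ProperSpace E := FiniteDimensional.proper ℝ E
  have hi : ∀ J : Finset κ, Integrable (fun ω => ∑ i ∈ J, a i • ξ i ω) P := fun J =>
    integrable_finsetSum _ fun i _ => (hξ i).smul (a i)
  have hm : ∀ J : Finset κ, Measurable (fun ω => ∑ i ∈ J, a i • ξ i ω) := fun J =>
    Finset.measurable_fun_sum _ fun i _ => (hξm i).const_smul (a i)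
  have := hq.integral_le_integral_add (hi I) (hi Iᶜ) (hm I) (hm Iᶜ) ?_ ?_
  · simpa only [Finset.sum_add_sum_compl] using this
  · have h := hind.indepFun_finset I Iᶜ disjoint_compl_right hξm
    have hφ : ∀ J : Finset κ, Measurable fun z : J → E => ∑ i : J, a i • z i := fun J =>
      Finset.measurable_fun_sum _ fun i _ => (measurable_pi_apply i).const_smul (a i)
    convert h.comp (hφ I) (hφ Iᶜ) using 1
    · funext ω
      exact (Finset.sum_coe_sort I fun i => a i • ξ i ω).symm
    · funext ω
      exact (Finset.sum_coe_sort Iᶜ fun i => a i • ξ i ω).symm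
  · refine (integral_finsetSum _ fun i _ => (hξ i).smul (a i)).trans ?_
    exact Finset.sum_eq_zero fun i _ => by
      simp only [Pi.smul_apply, integral_smul, h0, smul_zero]

/-- Up to a factor two, all sign patterns (and all their restrictions) are equivalent. -/
lemma IsSublinear.integral_sum_le_add (hq : IsSublinear q) (hξ : ∀ i, Integrable (ξ i) P)
    (hξm : ∀ i, Measurable (ξ i)) (hind : iIndepFun ξ P) (h0 : ∀ i, ∫ ω, ξ i ω ∂P = 0)
    (a e : κ → ℝ) (hae : ∀ i, a i = 0 ∨ a i = e i ∨ a i = - e i) :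
    ∫ ω, q (∑ i, a i • ξ i ω) ∂P ≤
      ∫ ω, q (∑ i, e i • ξ i ω) ∂P + ∫ ω, q (∑ i, (- e i) • ξ i ω) ∂P := by
  classical
  set I : Finset κ := {i | a i = e i} with hI
  set J : Finset κ := {i | a i ≠ e i ∧ a i = - e i} with hJ
  have hs : ∀ ω, ∑ i, a i • ξ i ω = ∑ i ∈ I, e i • ξ i ω + ∑ i ∈ J, (- e i) • ξ i ω := by
    intro ω
    rw [hI, hJ, Finset.sum_filter, Finset.sum_filter, ← Finset.sum_add_distrib]
    refine Finset.sum_congr rfl fun i _ => ?_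
    by_cases h1 : a i = e i
    · simp [h1]
    · rcases hae i with h | h | h
      · by_cases h2 : a i = - e i
        · simp [h2, show ¬ (- e i = e i) from h2 ▸ h1]
        · rw [if_neg h1, if_neg (fun hh => h2 hh.2), h]; simp
      · exact absurd h h1
      · simp [h, show ¬ (- e i = e i) from h ▸ h1]
  have hi : ∀ (b : κ → ℝ) (J : Finset κ), Integrable (fun ω => q (∑ i ∈ J, b i • ξ i ω)) P :=
    fun b J => hq.integrable (integrable_finsetSum _ fun i _ => (hξ i).smul (b i))
  calc _ ≤ ∫ ω, (q (∑ i ∈ I, e i • ξ i ω) + q (∑ i ∈ J, (- e i) • ξ i ω)) ∂P := by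
        refine integral_mono (hi a _) ((hi e I).add (hi (fun i => - e i) J)) fun ω => ?_
        show q _ ≤ _
        rw [hs]; exact hq.add_le _ _
    _ = _ := integral_add (hi e I) (hi (fun i => - e i) J)
    _ ≤ _ := add_le_add (hq.integral_sum_le_integral_sum hξ hξm hind h0 e I)
        (hq.integral_sum_le_integral_sum hξ hξm hind h0 (fun i => - e i) J)

/-- Symmetrization. -/
lemma IsSublinear.integral_sum_le_rademacher [DecidableEq κ] (hq : IsSublinear q) (hξ : ∀ i, Integrable (ξ i) P)
    (hξm : ∀ i, Measurable (ξ i)) (hind : iIndepFun ξ P) (h0 : ∀ i, ∫ ω, ξ i ω ∂P = 0) :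
    2 ^ Fintype.card κ * ∫ ω, q (∑ i, ξ i ω) ∂P ≤
      2 * ∑ s : κ → ℤˣ, ∫ ω, q (∑ i, (((s i : ℤˣ) : ℤ) : ℝ) • ξ i ω) ∂P := by
  -- Each pattern `s`, together with its opposite, dominates the pattern of all ones. Summing over
  -- `s`, both terms give the same total, as negation permutes the patterns.
  have h1 : ∀ s : κ → ℤˣ, ∫ ω, q (∑ i, ξ i ω) ∂P ≤
      ∫ ω, q (∑ i, (((s i : ℤˣ) : ℤ) : ℝ) • ξ i ω) ∂P +
      ∫ ω, q (∑ i, ((((-s) i : ℤˣ) : ℤ) : ℝ) • ξ i ω) ∂P := by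
    intro s
    have := hq.integral_sum_le_add hξ hξm hind h0 (fun _ => 1) (fun i => (((s i : ℤˣ) : ℤ) : ℝ))
      fun i => by rcases Int.units_eq_one_or (s i) with h | h <;> simp [h]
    simpa using this
  have h2 := Finset.sum_le_sum fun s (_ : s ∈ (Finset.univ : Finset (κ → ℤˣ))) => h1 s
  have h3 := Equiv.sum_comp (Equiv.neg (κ → ℤˣ))
    fun s => ∫ ω, q (∑ i, (((s i : ℤˣ) : ℤ) : ℝ) • ξ i ω) ∂P
  simp only [Equiv.neg_apply] at h3
  rw [Finset.sum_add_distrib, h3, ← two_mul, Finset.sum_const] at h2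
  simpa using h2

end Symmetrization

/-! ### Rademacher contraction for finite maxima -/

section Contraction

variable {ι : Type*} [Fintype ι] [Nonempty ι]

/-- The maximum of a finite family. -/
noncomputable def maxOver (v : ι → ℝ) : ℝ := Finset.univ.sup' Finset.univ_nonempty v

lemma le_maxOver (v : ι → ℝ) (t : ι) : v t ≤ maxOver v :=
  Finset.le_sup' v (Finset.mem_univ t)

lemma maxOver_le {v : ι → ℝ} {c : ℝ} (h : ∀ t, v t ≤ c) : maxOver v ≤ c :=
  Finset.sup'_le _ _ fun t _ => h t

lemma exists_maxOver_eq (v : ι → ℝ) : ∃ t, maxOver v = v t := by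
  obtain ⟨t, -, h⟩ := Finset.exists_mem_eq_sup' Finset.univ_nonempty v
  exact ⟨t, h⟩

lemma isSublinear_maxOver : IsSublinear (maxOver : (ι → ℝ) → ℝ) where
  add_le x y := maxOver_le fun t => add_le_add (le_maxOver x t) (le_maxOver y t)
  smul_eq c x hc := by
    apply le_antisymm
    · exact maxOver_le fun t => mul_le_mul_of_nonneg_left (le_maxOver x t) hc
    · obtain ⟨t, ht⟩ := exists_maxOver_eq x
      rw [ht]
      exact le_maxOver (c • x) t
  continuous := Continuous.finset_sup'_apply _ fun t _ => continuous_apply t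
  bound := ⟨1, fun x => by
    obtain ⟨t, ht⟩ := exists_maxOver_eq x
    rw [ht, one_mul]
    exact norm_le_pi_norm x t⟩

/-- With maximizers t and u on the left, the contribution of `φ` is at most |a t - a u|. According
to its sign, evaluate the right-hand maxima at (t, u) or at (u, t). -/
lemma maxOver_add_maxOver_sub_le (h φ a : ι → ℝ) (hφ : ∀ t u, |φ t - φ u| ≤ |a t - a u|) :
    maxOver (fun t => h t + φ t) + maxOver (fun t => h t - φ t) ≤
      maxOver (fun t => h t + a t) + maxOver (fun t => h t - a t) := by
  obtain ⟨t, ht⟩ := exists_maxOver_eq fun t => h t + φ t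
  obtain ⟨u, hu⟩ := exists_maxOver_eq fun t => h t - φ t
  rw [ht, hu]
  have h1 := le_maxOver (fun t => h t + a t) t
  have h2 := le_maxOver (fun t => h t - a t) t
  have h3 := le_maxOver (fun t => h t + a t) u
  have h4 := le_maxOver (fun t => h t - a t) u
  have h5 := (le_abs_self _).trans (hφ t u)
  rcases abs_cases (a t - a u) with ⟨e, -⟩ | ⟨e, -⟩ <;> rw [e] at h5 <;> linarith

lemma sum_units (f : ℤˣ → ℝ) : ∑ s, f s = f 1 + f (-1) := by
  have : (Finset.univ : Finset ℤˣ) = {1, -1} := rfl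
  rw [this, Finset.sum_pair (by decide)]

lemma sum_signs_succ {n : ℕ} (f : (Fin (n + 1) → ℤˣ) → ℝ) :
    ∑ s, f s = ∑ s : Fin n → ℤˣ, (f (Fin.cons 1 s) + f (Fin.cons (-1) s)) := by
  rw [← Equiv.sum_comp (Fin.consEquiv fun _ => ℤˣ), Fintype.sum_prod_type, sum_units,
    ← Finset.sum_add_distrib]
  rfl

/-- The contraction principle for Rademacher averages. -/
theorem sum_maxOver_contraction : ∀ (n : ℕ) (h : ι → ℝ) (φ a : Fin n → ι → ℝ),
    (∀ j t u, |φ j t - φ j u| ≤ |a j t - a j u|) →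
    ∑ s : Fin n → ℤˣ, maxOver (fun t => h t + ∑ j, (((s j : ℤˣ) : ℤ) : ℝ) * φ j t) ≤
      ∑ s : Fin n → ℤˣ, maxOver (fun t => h t + ∑ j, (((s j : ℤˣ) : ℤ) : ℝ) * a j t) := by
  intro n
  induction n with
  | zero => intro h φ a _; simp
  | succ n ih =>
    intro h φ a hφ
    rw [sum_signs_succ, sum_signs_succ, Finset.sum_add_distrib]
    simp only [Fin.sum_univ_succ, Fin.cons_zero, Fin.cons_succ]
    -- The first sign is frozen and its term absorbed into `h`, which is why the statement carries a
    -- free function `h`.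
    have h1 := ih (fun t => h t + φ 0 t) (fun j => φ j.succ) (fun j => a j.succ)
      fun j => hφ j.succ
    have h2 := ih (fun t => h t - φ 0 t) (fun j => φ j.succ) (fun j => a j.succ)
      fun j => hφ j.succ
    have h3 := Finset.sum_le_sum fun s (_ : s ∈ (Finset.univ : Finset (Fin n → ℤˣ))) =>
      maxOver_add_maxOver_sub_le
        (fun t => h t + ∑ j, (((s j : ℤˣ) : ℤ) : ℝ) * a j.succ t) (φ 0) (a 0) (hφ 0)
    rw [Finset.sum_add_distrib] at h3
    refine (le_of_eq_of_le ?_ (add_le_add h1 h2)).trans ((le_of_eq ?_).trans (h3.trans_eq ?_))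
    · congr 1 <;> refine Finset.sum_congr rfl fun s _ => ?_ <;> congr 1 <;> funext t <;>
        simp <;> ring
    · congr 1 <;> refine Finset.sum_congr rfl fun s _ => ?_ <;> congr 1 <;> funext t <;> ring
    · refine Finset.sum_congr rfl fun s _ => ?_
      congr 1 <;> congr 1 <;> funext t <;> simp <;> ring

end Contraction

/-! ### Continuity of seminorms and pairing with the dual ball -/

section Seminorm

variable {d : ℕ} (p : Seminorm ℝ (Vec d))

lemma exists_seminorm_le : ∃ C, 0 ≤ C ∧ ∀ x, p x ≤ C * ‖x‖ := by
  let b := EuclideanSpace.basisFun (Fin d) ℝ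
  refine ⟨∑ i, p (b i), Finset.sum_nonneg fun i _ => apply_nonneg p _, fun x => ?_⟩
  calc p x = p (∑ i, x i • b i) := by
        congr 1
        simpa [b] using (b.sum_repr x).symm
    _ ≤ ∑ i, p (x i • b i) := Finset.le_sum_of_subadditive p (map_zero p).le (map_add_le_add p) _ _
    _ ≤ ∑ i, p (b i) * ‖x‖ := by
        refine Finset.sum_le_sum fun i _ => ?_
        rw [map_smul_eq_mul, mul_comm]
        exact mul_le_mul_of_nonneg_left (PiLp.norm_apply_le x i) (apply_nonneg p _)
    _ = _ := (Finset.sum_mul _ _ _).symm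

lemma continuous_seminorm : Continuous p := by
  obtain ⟨C, hC, h⟩ := exists_seminorm_le p
  refine (LipschitzWith.of_dist_le_mul (K := ⟨C, hC⟩) fun x y => ?_).continuous
  rw [Real.dist_eq, dist_eq_norm]
  exact (abs_sub_map_le_sub p x y).trans (h _)

lemma isSublinear_seminorm : IsSublinear p where
  add_le := map_add_le_add p
  smul_eq c x hc := by rw [map_smul_eq_mul, Real.norm_eq_abs, abs_of_nonneg hc]
  continuous := continuous_seminorm p
  bound := by
    obtain ⟨C, -, h⟩ := exists_seminorm_le p
    exact ⟨C, fun x => by rw [Real.norm_eq_abs, abs_of_nonneg (apply_nonneg p x)]; exact h x⟩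

variable {p}

lemma inner_le_of_mem_dualBall (hp : ∀ v, p v = 0 → v = 0) {t : Vec d} (ht : t ∈ dualBall p)
    (x : Vec d) : ⟪t, x⟫ ≤ p x := by
  rcases (apply_nonneg p x).eq_or_lt with h | h
  · rw [hp x h.symm]; simp
  · have := ht ((p x)⁻¹ • x) (by
      rw [map_smul_eq_mul, Real.norm_eq_abs, abs_of_pos (inv_pos.2 h), inv_mul_cancel₀ h.ne'])
    rwa [inner_smul_right, inv_mul_le_iff₀ h, mul_one] at this

lemma abs_inner_le_of_mem_dualBall (hp : ∀ v, p v = 0 → v = 0) {t : Vec d}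
    (ht : t ∈ dualBall p) (x : Vec d) : |⟪t, x⟫| ≤ p x := by
  refine abs_le.2 ⟨?_, inner_le_of_mem_dualBall hp ht x⟩
  have := inner_le_of_mem_dualBall hp ht (-x)
  rw [inner_neg_right, map_neg_eq_map] at this
  linarith

end Seminorm

/-! ### Mean of the truncated process -/

/-- The truncation `u ↦ min (|u| / r) 1`. -/
noncomputable def trunc (r u : ℝ) : ℝ := min (|u| / r) 1

lemma trunc_nonneg {r : ℝ} (hr : 0 < r) (u : ℝ) : 0 ≤ trunc r u :=
  le_min (by positivity) zero_le_one

/-- This is the hypothesis of the contraction principle comparing the truncated process with the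
linear one. -/
lemma abs_trunc_sub_le (r u v : ℝ) :
    |trunc r u - trunc r v| ≤ |u / r - v / r| := by
  refine (abs_min_sub_min_le_max _ _ _ _).trans ?_
  rw [sub_self, abs_zero, max_eq_left (abs_nonneg _), ← sub_div, ← sub_div, abs_div, abs_div]
  exact div_le_div_of_nonneg_right (abs_abs_sub_abs_le_abs_sub u v) (abs_nonneg r)

lemma continuous_trunc (r : ℝ) : Continuous (trunc r) := by
  unfold trunc; fun_prop

section Expectation

variable {ι : Type*} [Fintype ι] [Nonempty ι] {Ω : Type*} [MeasurableSpace Ω] {P : Measure Ω}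
  [IsProbabilityMeasure P] {d n : ℕ} {p : Seminorm ℝ (Vec d)}

/-- Symmetrization and contraction for the truncated linear process. -/
theorem integral_maxOver_trunc_le (hp : ∀ v, p v = 0 → v = 0) (t : ι → Vec d)
    (ht : ∀ i, t i ∈ dualBall p) (W : Fin n → Ω → Vec d) (hWm : ∀ j, Measurable (W j))
    (hWi : ∀ j, Integrable (W j) P) (hind : iIndepFun W P) {r : ℝ} (hr : 0 < r) {A B : ℝ}
    (hA : ∀ i, ∑ j, ∫ ω, |⟪t i, W j ω⟫| ∂P ≤ A)
    (hB : ∀ s : Fin n → ℤˣ, ∫ ω, p (∑ j, (((s j : ℤˣ) : ℤ) : ℝ) • W j ω) ∂P ≤ B) :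
    ∫ ω, maxOver (fun i => ∑ j, trunc r ⟪t i, W j ω⟫) ∂P ≤ (A + 4 * B) / r := by
  have hS := isSublinear_maxOver (ι := ι)
  -- All directions are gathered in one vector of `ι → ℝ`, so that the maximum over them is the
  -- sublinear functional `maxOver`.
  set Φ : Vec d → ι → ℝ := fun z i => trunc r ⟪t i, z⟫ with hΦ
  have cΦ : Continuous Φ := continuous_pi fun i => (continuous_trunc r).comp (by fun_prop)
  have iΦ : ∀ j, Integrable (fun ω => Φ (W j ω)) P := fun j =>
    Integrable.of_bound (C := 1) (cΦ.measurable.comp (hWm j)).aestronglyMeasurable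
      (.of_forall fun ω => (pi_norm_le_iff_of_nonneg zero_le_one).2 fun i => by
        rw [Real.norm_eq_abs, abs_of_nonneg (trunc_nonneg hr _)]; exact min_le_right _ _)
  set c : Fin n → ι → ℝ := fun j => ∫ ω, Φ (W j ω) ∂P with hc
  have cval : ∀ j i, c j i = ∫ ω, trunc r ⟪t i, W j ω⟫ ∂P := fun j i =>
    eval_integral (fun i => (integrable_pi_iff.1 (iΦ j)) i) i
  set ξ : Fin n → Ω → ι → ℝ := fun j ω => Φ (W j ω) - c j with hξ
  have iξ : ∀ j, Integrable (ξ j) P := fun j => (iΦ j).sub (integrable_const _)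
  -- symmetrization
  have h1 := hS.integral_sum_le_rademacher (P := P) (ξ := ξ) iξ
    (fun j => (cΦ.measurable.comp (hWm j)).sub_const _)
    (hind.comp (fun j z => Φ z - c j) fun j => cΦ.measurable.sub_const _)
    (fun j => by
      show ∫ ω, (Φ (W j ω) - c j) ∂P = 0
      rw [integral_sub (iΦ j) (integrable_const _), integral_const, probReal_univ, one_smul,
        sub_self])
  rw [Fintype.card_fin] at h1
  -- the signed sums
  have iM : ∀ s : Fin n → ℤˣ,
      Integrable (fun ω => maxOver (∑ j, (((s j : ℤˣ) : ℤ) : ℝ) • Φ (W j ω))) P := fun s =>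
    hS.integrable (integrable_finsetSum _ fun j _ => (iΦ j).smul (((s j : ℤˣ) : ℤ) : ℝ))
  -- The centring `c` is removed again: by sublinearity it costs `maxOver` of the sum of the -s_j
  -- c_j, which by Jensen is at most the uncentred mean for the pattern `-s`.
  have h2 : ∀ s : Fin n → ℤˣ, ∫ ω, maxOver (∑ j, (((s j : ℤˣ) : ℤ) : ℝ) • ξ j ω) ∂P ≤
      ∫ ω, maxOver (∑ j, (((s j : ℤˣ) : ℤ) : ℝ) • Φ (W j ω)) ∂P +
      ∫ ω, maxOver (∑ j, ((((-s) j : ℤˣ) : ℤ) : ℝ) • Φ (W j ω)) ∂P := by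
    intro s
    have e : ∑ j, ((((-s) j : ℤˣ) : ℤ) : ℝ) • c j
        = ∫ ω, ∑ j, ((((-s) j : ℤˣ) : ℤ) : ℝ) • Φ (W j ω) ∂P := by
      refine Eq.trans ?_
        (integral_finsetSum _ fun j _ => (iΦ j).smul ((((-s) j : ℤˣ) : ℤ) : ℝ)).symm
      simp only [Pi.smul_apply, integral_smul, hc]
    have jensen : maxOver (∑ j, ((((-s) j : ℤˣ) : ℤ) : ℝ) • c j) ≤
        ∫ ω, maxOver (∑ j, ((((-s) j : ℤˣ) : ℤ) : ℝ) • Φ (W j ω)) ∂P := by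
      rw [e]
      exact hS.convexOn.map_integral_le hS.continuous.continuousOn isClosed_univ
        (.of_forall fun _ => Set.mem_univ _)
        (integrable_finsetSum _ fun j _ => (iΦ j).smul ((((-s) j : ℤˣ) : ℤ) : ℝ)) (iM (-s))
    refine le_trans ?_ (add_le_add le_rfl jensen)
    rw [← one_smul ℝ (maxOver (∑ j, ((((-s) j : ℤˣ) : ℤ) : ℝ) • c j)),
      ← probReal_univ (μ := P), ← integral_const, ← integral_add (iM s) (integrable_const _)]
    refine integral_mono (hS.integrable (integrable_finsetSum _ fun j _ => (iξ j).smul (((s j : ℤˣ) : ℤ) : ℝ)))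
      ((iM s).add (integrable_const _)) fun ω => ?_
    show maxOver (∑ j, (((s j : ℤˣ) : ℤ) : ℝ) • ξ j ω) ≤ _
    refine le_of_eq_of_le (congrArg maxOver ?_) (hS.add_le _ _)
    rw [← Finset.sum_add_distrib]
    refine Finset.sum_congr rfl fun j _ => ?_
    simp [hξ, sub_eq_add_neg]
  have h3 := Finset.sum_le_sum fun s (_ : s ∈ (Finset.univ : Finset (Fin n → ℤˣ))) => h2 s
  have h4 := Equiv.sum_comp (Equiv.neg (Fin n → ℤˣ))
    fun s => ∫ ω, maxOver (∑ j, (((s j : ℤˣ) : ℤ) : ℝ) • Φ (W j ω)) ∂P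
  simp only [Equiv.neg_apply] at h4
  rw [Finset.sum_add_distrib, h4] at h3
  -- contraction
  have iP : ∀ s : Fin n → ℤˣ,
      Integrable (fun ω => p (∑ j, (((s j : ℤˣ) : ℤ) : ℝ) • W j ω) / r) P := fun s =>
    ((isSublinear_seminorm p).integrable
      (integrable_finsetSum _ fun j _ => (hWi j).smul (((s j : ℤˣ) : ℤ) : ℝ))).div_const r
  have h5 : ∑ s : Fin n → ℤˣ, ∫ ω, maxOver (∑ j, (((s j : ℤˣ) : ℤ) : ℝ) • Φ (W j ω)) ∂P ≤
      ∑ s : Fin n → ℤˣ, ∫ ω, p (∑ j, (((s j : ℤˣ) : ℤ) : ℝ) • W j ω) / r ∂P := by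
    rw [← integral_finsetSum _ fun s _ => iM s, ← integral_finsetSum _ fun s _ => iP s]
    refine integral_mono (integrable_finsetSum _ fun s _ => iM s)
      (integrable_finsetSum _ fun s _ => iP s) fun ω => ?_
    show ∑ s : Fin n → ℤˣ, maxOver (∑ j, (((s j : ℤˣ) : ℤ) : ℝ) • Φ (W j ω)) ≤
      ∑ s : Fin n → ℤˣ, p (∑ j, (((s j : ℤˣ) : ℤ) : ℝ) • W j ω) / r
    have := sum_maxOver_contraction n (fun _ : ι => 0) (fun j i => trunc r ⟪t i, W j ω⟫)
      (fun j i => ⟪t i, W j ω⟫ / r) fun j i k => abs_trunc_sub_le r _ _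
    simp only [zero_add] at this
    refine le_trans (le_of_eq ?_) (this.trans (Finset.sum_le_sum fun s _ => maxOver_le fun i => ?_))
    · refine Finset.sum_congr rfl fun s _ => congrArg maxOver ?_
      funext i
      simp [hΦ, Finset.sum_apply]
    · have := inner_le_of_mem_dualBall hp (ht i) (∑ j, (((s j : ℤˣ) : ℤ) : ℝ) • W j ω)
      simp only [inner_sum, inner_smul_right] at this
      rw [le_div_iff₀ hr, Finset.sum_mul]
      refine le_of_eq_of_le (Finset.sum_congr rfl fun j _ => ?_) this
      field_simp
  have h6 : ∑ s : Fin n → ℤˣ, ∫ ω, p (∑ j, (((s j : ℤˣ) : ℤ) : ℝ) • W j ω) / r ∂P ≤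
      2 ^ n * (B / r) := by
    have := Finset.sum_le_card_nsmul (Finset.univ : Finset (Fin n → ℤˣ))
      (fun s => ∫ ω, p (∑ j, (((s j : ℤˣ) : ℤ) : ℝ) • W j ω) / r ∂P) (B / r) fun s _ => by
        rw [integral_div]; exact div_le_div_of_nonneg_right (hB s) hr.le
    simpa using this
  -- The factor 4 is 2 from symmetrization times 2 from removing the centring.
  have h7 : ∫ ω, maxOver (∑ j, ξ j ω) ∂P ≤ 4 * B / r := by
    have : (2 : ℝ) ^ n * ∫ ω, maxOver (∑ j, ξ j ω) ∂P ≤ 2 ^ n * (4 * B / r) := by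
      have : (2 : ℝ) ^ n * (4 * B / r) = 4 * (2 ^ n * (B / r)) := by ring
      linarith
    exact le_of_mul_le_mul_left this (by positivity)
  -- the mean
  have h8 : maxOver (∑ j, c j) ≤ A / r := by
    refine maxOver_le fun i => ?_
    rw [Finset.sum_apply]
    refine le_trans (Finset.sum_le_sum fun j _ => ?_)
      ((Finset.sum_div _ _ _).symm.le.trans (div_le_div_of_nonneg_right (hA i) hr.le))
    rw [cval, ← integral_div]
    refine integral_mono ((integrable_pi_iff.1 (iΦ j)) i) ?_ fun ω => min_le_left _ _
    exact (((hWi j).const_inner (t i)).abs).div_const r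
  calc ∫ ω, maxOver (fun i => ∑ j, trunc r ⟪t i, W j ω⟫) ∂P
      ≤ ∫ ω, (maxOver (∑ j, ξ j ω) + maxOver (∑ j, c j)) ∂P := by
        refine integral_mono ?_ ((hS.integrable (integrable_finsetSum _ fun j _ => iξ j)).add
          (integrable_const _)) fun ω => ?_
        · convert hS.integrable (integrable_finsetSum Finset.univ fun j _ => iΦ j) using 3 with ω
          funext i
          simp [hΦ, Finset.sum_apply]
        · refine le_of_eq_of_le (congrArg maxOver ?_) (hS.add_le _ _)
          funext i
          simp [hξ, hΦ, Finset.sum_apply]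
    _ ≤ 4 * B / r + A / r := by
        rw [integral_add (hS.integrable (integrable_finsetSum _ fun j _ => iξ j))
          (integrable_const _), integral_const, probReal_univ, one_smul]
        exact add_le_add h7 h8
    _ = _ := by ring

end Expectation

/-! ### Moments and independence of the block means -/

section Blocks

variable {d n N : ℕ}

lemma disjoint_block {j k : Fin n} (h : j ≠ k) : Disjoint (block n N j) (block n N k) := by
  rw [Finset.disjoint_left]
  intro i hj hk
  simp only [block, Finset.mem_filter, Finset.mem_univ, true_and] at hj hk
  have h1 : (j : ℕ) < k + 1 := lt_of_mul_lt_mul_right (hj.1.trans_lt hk.2) (Nat.zero_le _)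
  have h2 : (k : ℕ) < j + 1 := lt_of_mul_lt_mul_right (hk.1.trans_lt hj.2) (Nat.zero_le _)
  exact h (Fin.ext (by omega))

lemma card_block (j : Fin n) : (block n N j).card = N / n := by
  have : (block n N j).map Fin.valEmbedding =
      Finset.Ico ((j : ℕ) * (N / n)) (((j : ℕ) + 1) * (N / n)) := by
    ext i
    simp only [block, Finset.mem_map, Finset.mem_filter, Finset.mem_univ, true_and,
      Fin.valEmbedding_apply, Finset.mem_Ico]
    constructor
    · rintro ⟨a, ha, rfl⟩; exact ha
    · intro hi
      refine ⟨⟨i, hi.2.trans_le ?_⟩, hi, rfl⟩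
      calc ((j : ℕ) + 1) * (N / n) ≤ n * (N / n) := Nat.mul_le_mul_right _ j.2
        _ ≤ N := Nat.mul_div_le N n
  rw [← Finset.card_map, this, Nat.card_Ico, ← Nat.sub_mul]
  simp

lemma blockMean_sub (hm : 1 ≤ N / n) (x : Fin N → Vec d) (j : Fin n) (v : Vec d) :
    blockMean n x j - v = ((N / n : ℕ) : ℝ)⁻¹ • ∑ i ∈ block n N j, (x i - v) := by
  have : ((N / n : ℕ) : ℝ) ≠ 0 := by positivity
  rw [Finset.sum_sub_distrib, Finset.sum_const, card_block, smul_sub, ← Nat.cast_smul_eq_nsmul ℝ,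
    smul_smul, inv_mul_cancel₀ this, one_smul]
  rfl

lemma weakStd_nonneg (ν : Measure (Vec d)) (p : Seminorm ℝ (Vec d)) : 0 ≤ weakStd p ν :=
  Real.iSup_nonneg fun _ => Real.sqrt_nonneg _

lemma measurable_const_smul_sum {Ω κ : Type*} {mΩ : MeasurableSpace Ω} (c : ℝ) (s : Finset κ)
    {f : κ → Ω → Vec d} (hf : ∀ i ∈ s, Measurable (f i)) :
    Measurable fun ω => c • ∑ i ∈ s, f i ω :=
  (Finset.measurable_fun_sum s hf).const_smul c

variable (ν : Measure (Vec d)) [IsProbabilityMeasure ν]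

lemma integrable_eval_sub_mean (hν : MemLp (fun x : Vec d => x) 2 ν) (i : Fin N) :
    Integrable (fun x : Fin N → Vec d => x i - mean ν) (Measure.pi fun _ => ν) := by
  have h1 : Integrable (fun x : Vec d => x - mean ν) ν :=
    (hν.integrable one_le_two).sub (integrable_const _)
  exact (measurePreserving_eval (fun _ : Fin N => ν) i).integrable_comp_of_integrable h1

lemma integral_eval_sub_mean (hν : MemLp (fun x : Vec d => x) 2 ν) (i : Fin N) :
    ∫ x : Fin N → Vec d, (x i - mean ν) ∂(Measure.pi fun _ => ν) = 0 := by
  have h1 : ∫ x : Fin N → Vec d, (x i - mean ν) ∂(Measure.pi fun _ => ν)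
      = ∫ x, (x - mean ν) ∂ν :=
    integral_comp_eval (μ := fun _ : Fin N => ν) (f := fun x : Vec d => x - mean ν) (by fun_prop)
  rw [h1, integral_sub (hν.integrable one_le_two) (integrable_const _), integral_const,
    probReal_univ, one_smul]
  exact sub_self _

lemma iIndepFun_eval_sub_mean :
    iIndepFun (fun (i : Fin N) (x : Fin N → Vec d) => x i - mean ν) (Measure.pi fun _ => ν) :=
  iIndepFun_pi (X := fun _ x => x - mean ν) fun _ => by fun_prop

/-- Every signed sum of the centred data is controlled by the Rademacher mean. -/
lemma integral_seminorm_sum_le (p : Seminorm ℝ (Vec d)) (hν : MemLp (fun x : Vec d => x) 2 ν)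
    (hN : 1 ≤ N) (a : Fin N → ℝ) (ha : ∀ i, a i = 0 ∨ a i = 1 ∨ a i = -1) :
    ∫ x : Fin N → Vec d, p (∑ i, a i • (x i - mean ν)) ∂(Measure.pi fun _ => ν) ≤
      2 * Real.sqrt N * rademacherMean p N ν := by
  have hs : 0 < Real.sqrt N := Real.sqrt_pos.2 (by exact_mod_cast hN)
  -- The seminorm is even, so `s` and its opposite contribute equally; averaging over `s` then
  -- produces the Rademacher mean.
  have h1 : ∀ s : Fin N → ℤˣ,
      ∫ x : Fin N → Vec d, p (∑ i, a i • (x i - mean ν)) ∂(Measure.pi fun _ => ν) ≤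
      2 * Real.sqrt N * ∫ x : Fin N → Vec d,
        p ((Real.sqrt N)⁻¹ • ∑ i, (((s i : ℤˣ) : ℤ) : ℝ) • (x i - mean ν))
        ∂(Measure.pi fun _ : Fin N => ν) := by
    intro s
    have h := (isSublinear_seminorm p).integral_sum_le_add (integrable_eval_sub_mean ν hν)
      (fun i => (measurable_pi_apply i).sub_const _) (iIndepFun_eval_sub_mean ν)
      (integral_eval_sub_mean ν hν) a (fun i => (((s i : ℤˣ) : ℤ) : ℝ)) (fun i => by
        rcases Int.units_eq_one_or (s i) with h | h <;> rcases ha i with h' | h' | h' <;>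
          simp [h, h'])
    refine h.trans_eq ?_
    simp only [neg_smul, Finset.sum_neg_distrib, map_neg_eq_map, map_smul_eq_mul, norm_inv,
      Real.norm_eq_abs, abs_of_pos hs]
    rw [integral_const_mul]
    field_simp
    ring
  have h2 := Finset.sum_le_sum fun s (_ : s ∈ (Finset.univ : Finset (Fin N → ℤˣ))) => h1 s
  rw [← Finset.mul_sum, Finset.sum_const] at h2
  simp only [Finset.card_univ, Fintype.card_pi_const, Fintype.card_units_int, nsmul_eq_mul,
    Nat.cast_pow, Nat.cast_ofNat] at h2
  have h3 : (0 : ℝ) < 2 ^ N := by positivity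
  unfold rademacherMean
  rw [← mul_le_mul_iff_right₀ h3]
  refine h2.trans_eq ?_
  field_simp

/-- Signs attached to blocks are a particular pattern of coefficients in {-1, 0, 1} on the data,
with 0 at the points belonging to no block. -/
lemma integral_seminorm_sum_blockMean_le (p : Seminorm ℝ (Vec d))
    (hν : MemLp (fun x : Vec d => x) 2 ν) (hm : 1 ≤ N / n) (s : Fin n → ℤˣ) :
    ∫ x : Fin N → Vec d, p (∑ j, (((s j : ℤˣ) : ℤ) : ℝ) • (blockMean n x j - mean ν))
      ∂(Measure.pi fun _ => ν) ≤
      ((N / n : ℕ) : ℝ)⁻¹ * (2 * Real.sqrt N * rademacherMean p N ν) := by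
  classical
  have hN : 1 ≤ N := hm.trans (Nat.div_le_self _ _)
  set a : Fin N → ℝ := fun i => ∑ j, if i ∈ block n N j then (((s j : ℤˣ) : ℤ) : ℝ) else 0 with ha
  have ha' : ∀ i, a i = 0 ∨ a i = 1 ∨ a i = -1 := by
    intro i
    by_cases h : ∃ j, i ∈ block n N j
    · obtain ⟨j, hj⟩ := h
      have : a i = (((s j : ℤˣ) : ℤ) : ℝ) := by
        rw [ha]
        refine (Finset.sum_eq_single j (fun k _ hk => if_neg fun hi => ?_) (by simp)).trans
          (if_pos hj)
        exact Finset.disjoint_left.1 (disjoint_block hk) hi hj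
      rw [this]
      rcases Int.units_eq_one_or (s j) with h | h <;> simp [h]
    · push Not at h
      exact Or.inl (Finset.sum_eq_zero fun j _ => if_neg (h j))
  have e : ∀ x : Fin N → Vec d, ∑ j, (((s j : ℤˣ) : ℤ) : ℝ) • (blockMean n x j - mean ν) =
      ((N / n : ℕ) : ℝ)⁻¹ • ∑ i, a i • (x i - mean ν) := by
    intro x
    simp only [ha, Finset.sum_smul, ite_smul, zero_smul]
    rw [Finset.sum_comm, Finset.smul_sum]
    refine Finset.sum_congr rfl fun j _ => ?_
    rw [blockMean_sub hm, smul_comm, Finset.sum_ite_mem, Finset.univ_inter, Finset.smul_sum]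
  simp only [e, map_smul_eq_mul, norm_inv, Real.norm_natCast]
  rw [integral_const_mul]
  exact mul_le_mul_of_nonneg_left (integral_seminorm_sum_le ν p hν hN a ha') (by positivity)

lemma measurable_blockMean_sub (j : Fin n) (v : Vec d) :
    Measurable fun x : Fin N → Vec d => blockMean n x j - v := by
  unfold blockMean; fun_prop

lemma iIndepFun_blockMean_sub (hm : 1 ≤ N / n) :
    iIndepFun (fun (j : Fin n) (x : Fin N → Vec d) => blockMean n x j - mean ν)
      (Measure.pi fun _ => ν) := by
  refine iIndepFun_of_measurable_iSup (iIndepFun_eval_sub_mean ν)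
    (fun i => (measurable_pi_apply i).sub_const _) (fun j => (block n N j : Set (Fin N)))
    (fun j k h => by simpa using disjoint_block h) fun j => ?_
  simp only [blockMean_sub hm]
  refine measurable_const_smul_sum _ _ fun i hi => ?_
  refine Measurable.mono (comap_measurable fun x : Fin N → Vec d => x i - mean ν) ?_ le_rfl
  exact le_iSup₂_of_le (f := fun i (_ : i ∈ (block n N j : Set (Fin N))) =>
    MeasurableSpace.comap (fun x : Fin N → Vec d => x i - mean ν) inferInstance) i hi le_rfl

lemma integrable_blockMean_sub (hν : MemLp (fun x : Vec d => x) 2 ν) (hm : 1 ≤ N / n)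
    (j : Fin n) : Integrable (fun x : Fin N → Vec d => blockMean n x j - mean ν)
      (Measure.pi fun _ => ν) := by
  simp only [blockMean_sub hm]
  exact (integrable_finsetSum _ fun i _ => integrable_eval_sub_mean ν hν i).smul
    (((N / n : ℕ) : ℝ)⁻¹)

lemma bddAbove_dualBall_norm {p : Seminorm ℝ (Vec d)} :
    ∃ C, 0 ≤ C ∧ ∀ t ∈ dualBall p, ‖t‖ ≤ C := by
  obtain ⟨C, hC, h⟩ := exists_seminorm_le p
  refine ⟨C + 1, by linarith, fun t ht => ?_⟩
  rcases eq_or_ne t 0 with rfl | h0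
  · simpa using by linarith
  have hn : 0 < ‖t‖ := norm_pos_iff.2 h0
  have hC1 : 0 < C + 1 := by linarith
  -- Test `t` against a multiple of itself lying in the unit ball; `C + 1` replaces `C`, which may
  -- vanish.
  have := ht (((C + 1) * ‖t‖)⁻¹ • t) (by
    refine (h _).trans ?_
    rw [norm_smul, norm_inv, Real.norm_eq_abs, abs_of_pos (by positivity)]
    rw [mul_inv, mul_assoc, inv_mul_cancel₀ hn.ne', mul_one, ← div_eq_mul_inv]
    rw [div_le_one hC1]; linarith)
  rw [inner_smul_right, real_inner_self_eq_norm_sq] at this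
  have e : ((C + 1) * ‖t‖)⁻¹ * ‖t‖ ^ 2 = ‖t‖ / (C + 1) := by field_simp
  rwa [e, div_le_one hC1] at this

lemma integral_inner_sq_le_weakStd {p : Seminorm ℝ (Vec d)}
    (hν : MemLp (fun x : Vec d => x) 2 ν) {t : Vec d} (ht : t ∈ dualBall p) :
    ∫ x, ⟪t, x - mean ν⟫ ^ 2 ∂ν ≤ weakStd p ν ^ 2 := by
  have hm : MemLp (fun x : Vec d => x - mean ν) 2 ν := hν.sub (memLp_const _)
  have h1 : Real.sqrt (∫ x, ⟪t, x - mean ν⟫ ^ 2 ∂ν) ≤ weakStd p ν := by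
    -- A real supremum over an unbounded family would be 0 by convention, so boundedness of the dual
    -- ball is essential here.
    refine le_ciSup (f := fun t : dualBall p => Real.sqrt (∫ x, ⟪(t : Vec d), x - mean ν⟫ ^ 2 ∂ν))
      ?_ ⟨t, ht⟩
    obtain ⟨C, hC, h⟩ := bddAbove_dualBall_norm (p := p)
    refine ⟨Real.sqrt (∫ x, C ^ 2 * ‖x - mean ν‖ ^ 2 ∂ν), ?_⟩
    rintro _ ⟨u, rfl⟩
    refine Real.sqrt_le_sqrt (integral_mono (hm.const_inner _).integrable_sq
      (hm.norm.integrable_sq.const_mul _) fun x => ?_)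
    show ⟪(u : Vec d), x - mean ν⟫ ^ 2 ≤ C ^ 2 * ‖x - mean ν‖ ^ 2
    rw [← mul_pow, ← sq_abs]
    refine pow_le_pow_left₀ (abs_nonneg _) ((abs_real_inner_le_norm _ _).trans ?_) 2
    exact mul_le_mul_of_nonneg_right (h _ u.2) (norm_nonneg _)
  have h0 : 0 ≤ ∫ x, ⟪t, x - mean ν⟫ ^ 2 ∂ν := integral_nonneg fun _ => sq_nonneg _
  rw [← Real.sq_sqrt h0]
  exact pow_le_pow_left₀ (Real.sqrt_nonneg _) h1 2

/-- The variance of |f| is nonnegative. -/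
lemma integral_abs_le_sqrt {Ω : Type*} [MeasurableSpace Ω] {P : Measure Ω}
    [IsProbabilityMeasure P] {f : Ω → ℝ} (hf : MemLp f 2 P) :
    ∫ ω, |f ω| ∂P ≤ Real.sqrt (∫ ω, f ω ^ 2 ∂P) := by
  have h := variance_eq_sub hf.norm
  have h0 := variance_nonneg (fun ω => ‖f ω‖) P
  refine Real.le_sqrt_of_sq_le ?_
  simp only [Real.norm_eq_abs, Pi.pow_def, sq_abs] at h h0
  linarith

/-- The first moment is bounded by the second, and variances of independent summands add up over the
block. -/
lemma integral_abs_inner_blockMean_le {p : Seminorm ℝ (Vec d)}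
    (hν : MemLp (fun x : Vec d => x) 2 ν) (hm : 1 ≤ N / n) {t : Vec d} (ht : t ∈ dualBall p)
    (j : Fin n) :
    ∫ x : Fin N → Vec d, |⟪t, blockMean n x j - mean ν⟫| ∂(Measure.pi fun _ => ν) ≤
      weakStd p ν / Real.sqrt ((N / n : ℕ) : ℝ) := by
  set m := N / n with hm'
  have hmp : (0 : ℝ) < m := by exact_mod_cast hm
  set P : Measure (Fin N → Vec d) := Measure.pi fun _ => ν with hP
  have hm2 : MemLp (fun x : Vec d => ⟪t, x - mean ν⟫) 2 ν :=
    (hν.sub (memLp_const (mean ν))).const_inner t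
  set Y : Fin N → (Fin N → Vec d) → ℝ := fun i x => ⟪t, x i - mean ν⟫ with hY
  have Y2 : ∀ i, MemLp (Y i) 2 P := fun i =>
    hm2.comp_measurePreserving (measurePreserving_eval (fun _ : Fin N => ν) i)
  have Yind : iIndepFun Y P :=
    (iIndepFun_eval_sub_mean ν).comp (fun _ x => ⟪t, x⟫) fun _ => by fun_prop
  have Y0 : ∀ i, ∫ x, Y i x ∂P = 0 := fun i => by
    rw [hY, integral_inner (integrable_eval_sub_mean ν hν i), integral_eval_sub_mean ν hν,
      inner_zero_right]
  have Ysq : ∀ i, ∫ x, Y i x ^ 2 ∂P ≤ weakStd p ν ^ 2 := fun i => by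
    refine le_of_eq_of_le ?_ (integral_inner_sq_le_weakStd ν hν ht)
    exact integral_comp_eval (μ := fun _ : Fin N => ν)
      (f := fun x : Vec d => ⟪t, x - mean ν⟫ ^ 2)
      (Continuous.aestronglyMeasurable (by fun_prop))
  have e : ∀ x : Fin N → Vec d, ⟪t, blockMean n x j - mean ν⟫ =
      (m : ℝ)⁻¹ * (∑ i ∈ block n N j, Y i) x := fun x => by
    rw [blockMean_sub hm, inner_smul_right, inner_sum, Finset.sum_apply]
  have S2 : MemLp (∑ i ∈ block n N j, Y i) 2 P := memLp_finsetSum' _ fun i _ => Y2 i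
  have hvar := IndepFun.variance_sum (s := block n N j) (fun i _ => Y2 i)
    fun i _ k _ hik => Yind.indepFun hik
  rw [variance_of_integral_eq_zero S2.aestronglyMeasurable.aemeasurable (by
    simp only [Finset.sum_apply]
    rw [integral_finsetSum _ fun i _ => (Y2 i).integrable one_le_two]
    exact Finset.sum_eq_zero fun i _ => Y0 i)] at hvar
  have hS : ∫ x, (∑ i ∈ block n N j, Y i) x ^ 2 ∂P ≤ m * weakStd p ν ^ 2 := by
    rw [hvar]
    refine (Finset.sum_le_card_nsmul _ _ (weakStd p ν ^ 2) fun i _ => ?_).trans_eq ?_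
    · rw [variance_of_integral_eq_zero (Y2 i).aestronglyMeasurable.aemeasurable (Y0 i)]
      exact Ysq i
    · rw [card_block, nsmul_eq_mul]
  have h1 := (integral_abs_le_sqrt S2).trans (Real.sqrt_le_sqrt hS)
  rw [Real.sqrt_mul hmp.le, Real.sqrt_sq (weakStd_nonneg ν p)] at h1
  simp only [e, abs_mul, abs_inv, Nat.abs_cast]
  rw [integral_const_mul, inv_mul_le_iff₀ hmp]
  refine h1.trans_eq ?_
  have hs := Real.mul_self_sqrt hmp.le
  have hs' : 0 < Real.sqrt m := Real.sqrt_pos.2 hmp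
  field_simp
  linear_combination (weakStd p ν) * hs

end Blocks

/-! ### The norm is determined by the extreme points of the dual ball -/

section Duality

variable {d : ℕ} {p : Seminorm ℝ (Vec d)}

lemma convex_dualBall : Convex ℝ (dualBall p) := by
  intro s hs t ht a b ha hb hab x hx
  rw [inner_add_left, real_inner_smul_left, real_inner_smul_left]
  nlinarith [hs x hx, ht x hx]

lemma isCompact_dualBall : IsCompact (dualBall p) := by
  refine Metric.isCompact_of_isClosed_isBounded ?_ ?_
  · have : dualBall p = ⋂ (x : Vec d) (_ : p x ≤ 1), {t | ⟪t, x⟫ ≤ 1} := by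
      ext t; simp [dualBall]
    rw [this]
    exact isClosed_iInter fun x => isClosed_iInter fun _ =>
      isClosed_le (by fun_prop) continuous_const
  · obtain ⟨C, -, h⟩ := bddAbove_dualBall_norm (p := p)
    exact isBounded_iff_forall_norm_le.2 ⟨C, h⟩

/-- Hahn–Banach: a functional strictly separating v/c from the closed unit ball, normalized by the
separating constant. -/
lemma exists_mem_dualBall_lt_inner {v : Vec d} {c : ℝ} (hc : 0 < c) (hv : c < p v) :
    ∃ t ∈ dualBall p, c < ⟪t, v⟫ := by
  have h1 : Convex ℝ {x : Vec d | p x ≤ 1} := by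
    simpa [Seminorm.closedBall_zero_eq] using p.convex_closedBall 0 1
  have h2 : IsClosed {x : Vec d | p x ≤ 1} := isClosed_le (continuous_seminorm p) continuous_const
  have h3 : c⁻¹ • v ∉ {x : Vec d | p x ≤ 1} := by
    simp only [Set.mem_ofPred_eq, not_le, map_smul_eq_mul, norm_inv, Real.norm_eq_abs,
      abs_of_pos hc]
    rwa [lt_inv_mul_iff₀ hc, mul_one]
  obtain ⟨f, u, hf, hu⟩ := geometric_hahn_banach_closed_point h1 h2 h3
  have u0 : 0 < u := by simpa using hf 0 (by simp)
  have hin : ∀ x, ⟪u⁻¹ • (InnerProductSpace.toDual ℝ (Vec d)).symm f, x⟫ = u⁻¹ * f x := fun x => by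
    rw [real_inner_smul_left, InnerProductSpace.toDual_symm_apply]
  refine ⟨u⁻¹ • (InnerProductSpace.toDual ℝ (Vec d)).symm f, fun x hx => ?_, ?_⟩
  · rw [hin, inv_mul_le_iff₀ u0, mul_one]; exact (hf x hx).le
  · rw [hin, lt_inv_mul_iff₀ u0]
    rw [map_smul, smul_eq_mul, lt_inv_mul_iff₀ hc] at hu
    linarith

/-- Krein–Milman carries the bound from the extreme points to the whole dual ball, whose pairing
with `v` recovers `p v`. -/
lemma seminorm_le_of_forall_extremePoints {v : Vec d} {K : ℝ}
    (h : ∀ t ∈ Set.extremePoints ℝ (dualBall p), ⟪t, v⟫ ≤ K) : p v ≤ K := by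
  have key : ∀ t ∈ dualBall p, ⟪t, v⟫ ≤ K := by
    intro t ht
    rw [← closure_convexHull_extremePoints isCompact_dualBall convex_dualBall] at ht
    refine closure_minimal (convexHull_min (t := {t : Vec d | ⟪t, v⟫ ≤ K}) h ?_)
      (isClosed_le (by fun_prop) continuous_const) ht
    intro s hs t ht a b ha hb hab
    simp only [Set.mem_ofPred_eq] at *
    rw [inner_add_left, real_inner_smul_left, real_inner_smul_left]
    calc a * ⟪s, v⟫ + b * ⟪t, v⟫ ≤ a * K + b * K := by gcongr
      _ = K := by rw [← add_mul, hab, one_mul]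
  have K0 : 0 ≤ K := by simpa using key 0 fun x _ => by simp
  by_contra! hlt
  obtain ⟨t, ht, h'⟩ := exists_mem_dualBall_lt_inner (p := p) (v := v) (c := (K + p v) / 2) (by linarith)
    (by linarith)
  linarith [key t ht]

end Duality

/-- A monotone condition on a count is a finite union of finite intersections. Hence the slab unions
are closed and the bad events open. -/
lemma setOf_ncard_eq_biUnion {α : Type*} {n : ℕ} (Q : ℕ → Prop) (hQ : ∀ a b, a ≤ b → Q a → Q b)
    (R : Fin n → α → Prop) [DecidablePred fun J : Finset (Fin n) => Q J.card] :
    {y | Q ({j | R j y} : Set (Fin n)).ncard} =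
      ⋃ J ∈ (Finset.univ.filter fun J : Finset (Fin n) => Q J.card), ⋂ j ∈ J, {y | R j y} := by
  classical
  ext y
  simp only [Set.mem_ofPred_eq, Set.mem_iUnion, Set.mem_iInter, Finset.mem_filter, Finset.mem_univ,
    true_and, exists_prop]
  constructor
  · intro h
    refine ⟨Finset.univ.filter fun j => R j y, ?_, by simp⟩
    rwa [← Set.ncard_coe_finset, Finset.coe_filter_univ]
  · rintro ⟨J, hJ, h⟩
    refine hQ _ _ ?_ hJ
    rw [← Set.ncard_coe_finset]
    exact Set.ncard_le_ncard (fun j hj => h j hj) (Set.toFinite _)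

lemma one_le_numBlocks {δ : ℝ} (h0 : 0 < δ) (h1 : δ < 1) : 1 ≤ numBlocks δ := by
  refine Nat.one_le_ceil_iff.2 (Real.log_pos ?_)
  rw [lt_div_iff₀ h0]; linarith

/-! ### Feasible sets and the estimator, for a fixed sample -/

section Estimator

variable {d N : ℕ} {p : Seminorm ℝ (Vec d)} {δ : ℝ} {x : Fin N → Vec d}

lemma slabUnion_mono {n : ℕ} {ε ε' : ℝ} (h : ε ≤ ε') (t : Vec d) :
    slabUnion n x ε t ⊆ slabUnion n x ε' t := by
  intro y (hy : (n : ℝ) / 2 < _)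
  show (n : ℝ) / 2 < _
  refine lt_of_lt_of_le hy (Nat.cast_le.2 (Set.ncard_le_ncard (fun j hj => ?_) (Set.toFinite _)))
  exact le_trans hj h

lemma feasible_mono {ε ε' : ℝ} (h : ε ≤ ε') : feasible p δ x ε ⊆ feasible p δ x ε' :=
  Set.iInter₂_mono fun t _ => slabUnion_mono h t

lemma isClosed_slabUnion (n : ℕ) (ε : ℝ) (t : Vec d) : IsClosed (slabUnion n x ε t) := by
  classical
  have := setOf_ncard_eq_biUnion (α := Vec d) (n := n) (fun k => (n : ℝ) / 2 < k)
    (fun a b hab h => lt_of_lt_of_le h (Nat.cast_le.2 hab))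
    (fun j y => |⟪t, blockMean n x j⟫ - ⟪t, y⟫| ≤ ε)
  unfold slabUnion
  rw [this]
  refine isClosed_biUnion_finset fun J _ => isClosed_biInter fun j _ =>
    isClosed_le (by fun_prop) continuous_const

lemma isClosed_feasible (ε : ℝ) : IsClosed (feasible p δ x ε) :=
  isClosed_biInter fun _ _ => isClosed_slabUnion _ _ _

/-- Two majorities have a common block. -/
lemma abs_inner_sub_le_of_mem_slabUnion {n : ℕ} {ε ε' : ℝ} {t y y' : Vec d}
    (h : y ∈ slabUnion n x ε t) (h' : y' ∈ slabUnion n x ε' t) : |⟪t, y - y'⟫| ≤ ε + ε' := by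
  set A : Set (Fin n) := {j | |⟪t, blockMean n x j⟫ - ⟪t, y⟫| ≤ ε} with hA
  set B : Set (Fin n) := {j | |⟪t, blockMean n x j⟫ - ⟪t, y'⟫| ≤ ε'} with hB
  have hAc : (n : ℝ) / 2 < (A.ncard : ℝ) := h
  have hBc : (n : ℝ) / 2 < (B.ncard : ℝ) := h'
  have hne : (A ∩ B).Nonempty := by
    by_contra hemp
    have hd : Disjoint A B := Set.disjoint_iff_inter_eq_empty.2 (Set.not_nonempty_iff_eq_empty.1 hemp)
    have h1 := Set.ncard_union_eq hd (Set.toFinite _) (Set.toFinite _)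
    have h2 : (A ∪ B).ncard ≤ n := by
      simpa using Set.ncard_le_ncard (Set.subset_univ (A ∪ B)) (Set.toFinite _)
    have h3 : ((A.ncard + B.ncard : ℕ) : ℝ) ≤ n := by exact_mod_cast h1 ▸ h2
    push_cast at h3
    linarith
  obtain ⟨j, hj, hj'⟩ := hne
  have e : ⟪t, y - y'⟫ =
      (⟪t, blockMean n x j⟫ - ⟪t, y'⟫) - (⟪t, blockMean n x j⟫ - ⟪t, y⟫) := by
    rw [inner_sub_right]; ring
  rw [e]
  refine (abs_sub _ _).trans ?_
  have a1 : |⟪t, blockMean n x j⟫ - ⟪t, y⟫| ≤ ε := hj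
  have a2 : |⟪t, blockMean n x j⟫ - ⟪t, y'⟫| ≤ ε' := hj'
  linarith

lemma seminorm_sub_le_of_mem_feasible {ε ε' : ℝ} {y y' : Vec d}
    (h : y ∈ feasible p δ x ε) (h' : y' ∈ feasible p δ x ε') : p (y - y') ≤ ε + ε' :=
  seminorm_le_of_forall_extremePoints fun t ht =>
    (le_abs_self _).trans (abs_inner_sub_le_of_mem_slabUnion (Set.mem_iInter₂.1 h t ht)
      (Set.mem_iInter₂.1 h' t ht))

/-- By compactness `p` attains a positive minimum on the unit sphere; the sphere is empty only in
dimension 0. -/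
lemma exists_norm_le_seminorm (hp : ∀ v, p v = 0 → v = 0) : ∃ C, ∀ v, ‖v‖ ≤ C * p v := by
  by_cases hS : (Metric.sphere (0 : Vec d) 1).Nonempty
  · obtain ⟨u, hu, hmin⟩ := (isCompact_sphere (0 : Vec d) 1).exists_isMinOn hS
      (continuous_seminorm p).continuousOn
    have hu1 : ‖u‖ = 1 := by simpa using hu
    have pu : 0 < p u := by
      refine (apply_nonneg p u).lt_of_ne fun h => ?_
      rw [hp u h.symm, norm_zero] at hu1
      exact zero_ne_one hu1
    refine ⟨(p u)⁻¹, fun v => ?_⟩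
    rcases eq_or_ne v 0 with rfl | hv
    · simp
    have hn : 0 < ‖v‖ := norm_pos_iff.2 hv
    have h1 : p u ≤ p (‖v‖⁻¹ • v) := hmin (by simp [norm_smul, inv_mul_cancel₀ hn.ne'])
    rw [map_smul_eq_mul, norm_inv, norm_norm, ← div_eq_inv_mul, le_div_iff₀ hn] at h1
    rw [inv_mul_eq_div, le_div_iff₀ pu]
    linarith
  · refine ⟨0, fun v => ?_⟩
    rcases eq_or_ne v 0 with rfl | hv
    · simp
    · exact absurd ⟨‖v‖⁻¹ • v, by simp [norm_smul, inv_mul_cancel₀ (norm_ne_zero_iff.2 hv)]⟩ hS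

lemma isCompact_feasible (hp : ∀ v, p v = 0 → v = 0) (ε : ℝ) : IsCompact (feasible p δ x ε) := by
  refine Metric.isCompact_of_isClosed_isBounded (isClosed_feasible ε) ?_
  rcases (feasible p δ x ε).eq_empty_or_nonempty with h | ⟨y, hy⟩
  · rw [h]; exact Bornology.isBounded_empty
  obtain ⟨C, hC⟩ := exists_norm_le_seminorm hp
  refine isBounded_iff_forall_norm_le.2 ⟨|C| * (ε + ε) + ‖y‖, fun z hz => ?_⟩
  have h1 := hC (z - y)
  have h2 := seminorm_sub_le_of_mem_feasible hz hy
  have h3 : C * p (z - y) ≤ |C| * (ε + ε) :=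
    (mul_le_mul_of_nonneg_right (le_abs_self C) (apply_nonneg p _)).trans
      (mul_le_mul_of_nonneg_left h2 (abs_nonneg C))
  have h4 : ‖z‖ ≤ ‖z - y‖ + ‖y‖ := by simpa using norm_add_le (z - y) y
  linarith

lemma nonempty_setOf_feasible (hp : ∀ v, p v = 0 → v = 0) (h0 : 0 < δ) (h1 : δ < 1) :
    {ε : ℝ | 0 < ε ∧ (feasible p δ x ε).Nonempty}.Nonempty := by
  have hn := one_le_numBlocks h0 h1
  set n := numBlocks δ
  -- At this level the origin is within reach of every block, in every direction of the dual ball;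
  -- the added 1 makes the level positive.
  refine ⟨∑ j, p (blockMean n x j) + 1, by
    have : 0 ≤ ∑ j, p (blockMean n x j) := Finset.sum_nonneg fun j _ => apply_nonneg p _
    linarith, 0, Set.mem_iInter₂.2 fun t ht => ?_⟩
  have : ({j : Fin n | |⟪t, blockMean n x j⟫ - ⟪t, (0 : Vec d)⟫| ≤ ∑ j, p (blockMean n x j) + 1} :
      Set (Fin n)) = Set.univ := by
    refine Set.eq_univ_of_forall fun j => ?_
    have h2 := abs_inner_le_of_mem_dualBall hp (extremePoints_subset ht) (blockMean n x j)
    have h3 := Finset.single_le_sum (f := fun j => p (blockMean n x j))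
      (fun j _ => apply_nonneg p _) (Finset.mem_univ j)
    simp only [Set.mem_ofPred_eq, inner_zero_right, sub_zero]
    linarith
  show (n : ℝ) / 2 < _
  rw [this, Set.ncard_univ, Nat.card_fin]
  have : (1 : ℝ) ≤ n := by exact_mod_cast hn
  linarith

lemma bddBelow_setOf_feasible : BddBelow {ε : ℝ | 0 < ε ∧ (feasible p δ x ε).Nonempty} :=
  ⟨0, fun _ h => h.1.le⟩

lemma feasible_nonempty (hp : ∀ v, p v = 0 → v = 0) (h0 : 0 < δ) (h1 : δ < 1) {ε : ℝ}
    (h : epsZero p δ x < ε) : (feasible p δ x ε).Nonempty := by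
  obtain ⟨ε', h', hlt⟩ := exists_lt_of_csInf_lt (nonempty_setOf_feasible hp h0 h1) h
  exact h'.2.mono (feasible_mono hlt.le)

lemma estimateSet_nonempty (hp : ∀ v, p v = 0 → v = 0) (h0 : 0 < δ) (h1 : δ < 1) :
    (estimateSet p δ x).Nonempty := by
  unfold estimateSet
  rw [Set.biInter_eq_iInter]
  have : Nonempty (Set.Ioi (epsZero p δ x)) := Set.nonempty_Ioi.to_subtype
  refine IsCompact.nonempty_iInter_of_directed_nonempty_isCompact_isClosed _ ?_
    (fun ε => feasible_nonempty hp h0 h1 ε.2) (fun ε => isCompact_feasible hp _)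
    fun ε => isClosed_feasible _
  intro a b
  exact ⟨min a b, feasible_mono (min_le_left (a : ℝ) b), feasible_mono (min_le_right (a : ℝ) b)⟩

/-- If `y` is feasible at every level above `r`, the estimator is within `2 r` of `y`. -/
lemma seminorm_sub_le_of_mem_estimateSet {r : ℝ} (hr : 0 ≤ r) {y z : Vec d}
    (hz : z ∈ estimateSet p δ x) (hy : ∀ s, r < s → y ∈ feasible p δ x s) :
    p (z - y) ≤ 2 * r := by
  -- Membership in `estimateSet` only concerns levels strictly above ε₀, hence the two distinct
  -- margins η/4 and η/2.
  refine le_of_forall_pos_le_add fun η hη => ?_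
  have h1 : y ∈ feasible p δ x (r + η / 4) := hy _ (by linarith)
  have h2 : epsZero p δ x ≤ r + η / 4 :=
    csInf_le bddBelow_setOf_feasible ⟨by linarith, y, h1⟩
  have h3 : z ∈ feasible p δ x (r + η / 2) := Set.mem_iInter₂.1 hz _ (by
    rw [Set.mem_Ioi]
    linarith)
  linarith [seminorm_sub_le_of_mem_feasible h3 h1]

end Estimator

/-! ### Concentration of the largest count -/

section Tail

variable {ι : Type*} [Fintype ι] [Nonempty ι] {d n : ℕ}

/-- The largest number, over a finite family of directions, of coordinates outside a slab. -/
noncomputable def maxCount (t : ι → Vec d) (r : ℝ) (z : Fin n → Vec d) : ℝ :=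
  maxOver fun i => ∑ j, if r < |⟪t i, z j⟫| then (1 : ℝ) else 0

lemma measurable_maxCount (t : ι → Vec d) (r : ℝ) :
    Measurable (maxCount t r : (Fin n → Vec d) → ℝ) := by
  refine isSublinear_maxOver.continuous.measurable.comp (measurable_pi_lambda _ fun i => ?_)
  refine Finset.measurable_fun_sum _ fun j _ => Measurable.ite ?_ measurable_const measurable_const
  exact measurableSet_lt measurable_const (by fun_prop)

lemma maxCount_nonneg (t : ι → Vec d) (r : ℝ) (z : Fin n → Vec d) : 0 ≤ maxCount t r z :=
  (Finset.sum_nonneg fun j _ => by split_ifs <;> norm_num).trans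
    (le_maxOver (fun i => ∑ j, if r < |⟪t i, z j⟫| then (1 : ℝ) else 0) (Classical.arbitrary ι))

lemma maxCount_le (t : ι → Vec d) (r : ℝ) (z : Fin n → Vec d) : maxCount t r z ≤ n :=
  maxOver_le fun i => (Finset.sum_le_sum (g := fun _ => (1 : ℝ)) fun j _ => by
    split_ifs <;> norm_num).trans (by simp)

lemma maxCount_le_maxOver_trunc (t : ι → Vec d) {r : ℝ} (hr : 0 < r) (z : Fin n → Vec d) :
    maxCount t r z ≤ maxOver fun i => ∑ j, trunc r ⟪t i, z j⟫ := by
  refine maxOver_le fun i => le_trans (Finset.sum_le_sum fun j _ => ?_)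
    (le_maxOver (fun i => ∑ j, trunc r ⟪t i, z j⟫) i)
  split_ifs with h
  · exact le_min ((one_le_div hr).2 h.le) le_rfl
  · exact trunc_nonneg hr _

/-- Fix a direction. A coordinate of `x` outside the slab either agrees with that of some `y l`, and
is counted there, or agrees with none, and is counted by the last term. -/
lemma maxCount_le_sum_add (t : ι → Vec d) (r : ℝ) {q : ℕ} (x : Fin n → Vec d)
    (y : Fin q → Fin n → Vec d) :
    maxCount t r x ≤ ∑ l, maxCount t r (y l) +
      (({j | ∀ l, x j ≠ y l j} : Set (Fin n)).ncard : ℝ) := by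
  classical
  refine maxOver_le fun i => ?_
  have e : (({j | ∀ l, x j ≠ y l j} : Set (Fin n)).ncard : ℝ) =
      ∑ j, if ∀ l, x j ≠ y l j then (1 : ℝ) else 0 := by
    rw [Finset.sum_boole, ← Set.ncard_coe_finset, Finset.coe_filter_univ]
  have h1 : ∑ l, ∑ j, (if r < |⟪t i, y l j⟫| then (1 : ℝ) else 0) ≤ ∑ l, maxCount t r (y l) :=
    Finset.sum_le_sum fun l _ =>
      le_maxOver (fun i => ∑ j, if r < |⟪t i, y l j⟫| then (1 : ℝ) else 0) i
  rw [e]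
  refine le_trans ?_ (add_le_add h1 le_rfl)
  rw [Finset.sum_comm, ← Finset.sum_add_distrib]
  refine Finset.sum_le_sum fun j _ => ?_
  have nn : ∀ l, 0 ≤ (if r < |⟪t i, y l j⟫| then (1 : ℝ) else 0) := fun l => by
    split_ifs <;> norm_num
  have nn' := Finset.sum_nonneg fun l (_ : l ∈ Finset.univ) => nn l
  by_cases h : ∀ l, x j ≠ y l j
  · rw [if_pos h]
    split_ifs <;> linarith
  · rw [if_neg h, add_zero]
    push Not at h
    obtain ⟨l, hl⟩ := h
    rw [hl]
    exact Finset.single_le_sum (f := fun l => if r < |⟪t i, y l j⟫| then (1 : ℝ) else 0)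
      (fun l _ => nn l) (Finset.mem_univ l)

/-- Here 16^(3/8) = 2^(3/2) > e; the exponent 3n/8 arises below as n/2 - n/8. -/
lemma exp_le_sixteen_rpow (n : ℕ) : Real.exp n ≤ (16 : ℝ) ^ (3 * n / 8 : ℝ) := by
  rw [Real.rpow_def_of_pos (by norm_num), Real.exp_le_exp]
  have h : Real.log 16 = 4 * Real.log 2 := by
    rw [show (16 : ℝ) = 2 ^ 4 by norm_num, Real.log_pow]; norm_num
  have h2 := Real.log_two_gt_d9
  have hn : (0 : ℝ) ≤ n := Nat.cast_nonneg n
  rw [h]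
  nlinarith

/-- A small mean of the largest count entails exponential concentration. -/
theorem measureReal_half_le_maxCount_le (hn : 1 ≤ n) (μ : Fin n → Measure (Vec d))
    [∀ j, IsProbabilityMeasure (μ j)] (t : ι → Vec d) (r : ℝ)
    (hE : ∫ z, maxCount t r z ∂Measure.pi μ ≤ n / 256) :
    (Measure.pi μ).real {z | (n : ℝ) / 2 ≤ maxCount t r z} ≤ 2 ^ 16 * Real.exp (-n) := by
  classical
  have hn' : (0 : ℝ) < n := by exact_mod_cast hn
  set Q := Measure.pi μ
  have mf := measurable_maxCount (n := n) t r
  have if' : Integrable (fun z : Fin n → Vec d => maxCount t r z) Q :=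
    Integrable.of_bound mf.aestronglyMeasurable n (.of_forall fun z => by
      rw [Real.norm_eq_abs, abs_of_nonneg (maxCount_nonneg t r z)]; exact maxCount_le t r z)
  have hA : MeasurableSet {z : Fin n → Vec d | maxCount t r z ≤ n / 128} :=
    measurableSet_le mf measurable_const
  -- Sixteen points with count at most n/128 contribute at most n/8 in total, which is the shift in
  -- the exponent.
  set u : (Fin n → Vec d) → ℝ := fun z => (16 : ℝ) ^ (maxCount t r z - n / 8 : ℝ) with hu
  set g : (Fin n → Vec d) → ℝ := Set.indicator {z | maxCount t r z ≤ n / 128} 1 with hg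
  have um : Measurable u := measurable_const.pow (mf.sub_const _)
  have uC : ∀ z, u z ≤ (16 : ℝ) ^ (n : ℝ) := fun z =>
    Real.rpow_le_rpow_of_exponent_le (by norm_num) (by linarith [maxCount_le t r z])
  have u0 : ∀ z, 0 ≤ u z := fun z => Real.rpow_nonneg (by norm_num) _
  have key := integral_mul_prod_integral_le_one (E := Vec d) 16 (by norm_num) n μ u (fun _ => g)
    ((16 : ℝ) ^ (n : ℝ)) um (fun _ => measurable_one.indicator hA) u0 uC
    (fun _ z => Set.indicator_nonneg (fun _ _ => zero_le_one) z)
    (fun _ z => Set.indicator_le_self' (fun _ _ => zero_le_one) z) ?_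
  swap
  · intro x y
    by_cases h : ∀ l, maxCount t r (y l) ≤ n / 128
    · have e : ∏ l : Fin 16, g (y l) = 1 := Finset.prod_eq_one fun l _ => by
        have hl : y l ∈ {z : Fin n → Vec d | maxCount t r z ≤ n / 128} := h l
        rw [hg, Set.indicator_of_mem hl]; rfl
      rw [e, mul_one, ← Real.rpow_natCast]
      push_cast
      refine Real.rpow_le_rpow_of_exponent_le (by norm_num) ?_
      have h1 := maxCount_le_sum_add t r x y
      have h2 := Finset.sum_le_sum fun l (_ : l ∈ (Finset.univ : Finset (Fin 16))) => h l
      rw [Finset.sum_const, Finset.card_univ, Fintype.card_fin, nsmul_eq_mul] at h2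
      push_cast at h2
      linarith
    · push Not at h
      obtain ⟨l, hl⟩ := h
      rw [Finset.prod_eq_zero (Finset.mem_univ l), mul_zero]
      · positivity
      · have hl' : y l ∉ {z : Fin n → Vec d | maxCount t r z ≤ n / 128} := hl.not_ge
        exact Set.indicator_of_notMem hl' _
  -- Markov's inequality: n/128 is twice the bound assumed on the mean.
  have hg2 : 1 / 2 ≤ ∫ z, g z ∂Q := by
    rw [integral_indicator_one hA]
    have h1 := mul_meas_ge_le_integral_of_nonneg
      (.of_forall fun z => maxCount_nonneg t r z) if' (n / 128 : ℝ)
    have h2 : Q.real {z | (n : ℝ) / 128 ≤ maxCount t r z} ≤ 1 / 2 := by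
      have : (n : ℝ) / 128 * Q.real {z | (n : ℝ) / 128 ≤ maxCount t r z} ≤ n / 128 * (1 / 2) := by
        linarith
      exact le_of_mul_le_mul_left this (by positivity)
    have h3 := probReal_compl_eq_one_sub (μ := Q) hA
    have h4 : Q.real {z | maxCount t r z ≤ (n : ℝ) / 128}ᶜ ≤
        Q.real {z | (n : ℝ) / 128 ≤ maxCount t r z} := by
      refine measureReal_mono fun z hz => ?_
      simp only [Set.mem_compl_iff, Set.mem_ofPred_eq, not_le] at hz
      exact hz.le
    linarith
  rw [Finset.prod_const, Finset.card_univ, Fintype.card_fin] at key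
  have iu : Integrable u Q := Integrable.of_bound um.aestronglyMeasurable _
    (.of_forall fun z => by rw [Real.norm_eq_abs, abs_of_nonneg (u0 z)]; exact uC z)
  have hu2 : ∫ z, u z ∂Q ≤ 2 ^ 16 := by
    have h1 : (1 / 2 : ℝ) ^ 16 ≤ (∫ z, g z ∂Q) ^ 16 := pow_le_pow_left₀ (by norm_num) hg2 16
    have h2 := mul_le_mul_of_nonneg_left h1 (integral_nonneg (μ := Q) u0)
    have h3 : (∫ z, u z ∂Q) * (1 / 2) ^ 16 ≤ 1 := h2.trans key
    norm_num at h3 ⊢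
    linarith
  have h5 := mul_meas_ge_le_integral_of_nonneg (.of_forall u0) iu ((16 : ℝ) ^ (3 * n / 8 : ℝ))
  have h6 : Q.real {z | (n : ℝ) / 2 ≤ maxCount t r z} ≤
      Q.real {z | (16 : ℝ) ^ (3 * n / 8 : ℝ) ≤ u z} := by
    refine measureReal_mono fun z hz => ?_
    have hz : (n : ℝ) / 2 ≤ maxCount t r z := hz
    exact Real.rpow_le_rpow_of_exponent_le (by norm_num) (by linarith)
  rw [Real.exp_neg, ← div_eq_mul_inv, le_div_iff₀ (Real.exp_pos _)]
  calc _ ≤ Q.real {z | (16 : ℝ) ^ (3 * n / 8 : ℝ) ≤ u z} * (16 : ℝ) ^ (3 * n / 8 : ℝ) :=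
        mul_le_mul h6 (exp_le_sixteen_rpow n) (Real.exp_pos _).le measureReal_nonneg
    _ ≤ _ := by linarith

end Tail

/-! ### Choice of constants and the uniform bad event -/

section Main

variable {d N : ℕ} {p : Seminorm ℝ (Vec d)} {δ : ℝ} (ν : Measure (Vec d)) [IsProbabilityMeasure ν]

lemma exp_neg_numBlocks_le (h0 : 0 < δ) : Real.exp (-(numBlocks δ : ℝ)) ≤ δ / 2 := by
  have h := Nat.le_ceil (Real.log (2 / δ))
  calc Real.exp (-(numBlocks δ : ℝ)) ≤ Real.exp (-Real.log (2 / δ)) := Real.exp_le_exp.2 (by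
        unfold numBlocks; linarith)
    _ = δ / 2 := by rw [Real.exp_neg, Real.exp_log (by positivity), inv_div]

/-- The numerical relation between the number of blocks, their length and the sample size. -/
lemma blocks_arith {S M g r : ℝ} (h0 : 0 < δ) (h1 : δ < 1)
    (hN : numBlocks δ ≤ N) (hg : 0 ≤ g) (hr : 0 < r)
    (h : 5000 / Real.sqrt N * max M (g + S * Real.sqrt (Real.log (2 / δ))) ≤ r) :
    (numBlocks δ * (S / Real.sqrt ((N / numBlocks δ : ℕ) : ℝ)) +
      4 * (((N / numBlocks δ : ℕ) : ℝ)⁻¹ * (2 * Real.sqrt N * M))) / r ≤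
      (numBlocks δ : ℝ) / 256 := by
  have hn := one_le_numBlocks h0 h1
  set L := Real.log (2 / δ) with hL
  have hL2 : Real.log 2 ≤ L := Real.log_le_log (by norm_num) (by
    rw [le_div_iff₀ h0]; linarith)
  have hlog := Real.log_two_gt_d9
  have hL0 : 0 < L := by linarith
  -- The ceiling is less than L + 1, and L ≥ log 2 > 2/3.
  have hnL : (numBlocks δ : ℝ) ≤ 5 / 2 * L := by
    have := Nat.ceil_lt_add_one hL0.le
    have : (numBlocks δ : ℝ) < L + 1 := this
    linarith
  set n := numBlocks δ
  set m := N / n with hm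
  have hm1 : 1 ≤ m := (Nat.one_le_div_iff hn).2 hN
  -- Fewer than n points are left over, and n ≤ nm.
  have hN2 : N ≤ 2 * (n * m) := by
    have h := Nat.div_add_mod N n
    have h' := Nat.mod_lt N hn
    rw [← hm] at h
    have : n * 1 ≤ n * m := Nat.mul_le_mul_left n hm1
    omega
  have hN2' : (N : ℝ) ≤ 2 * (n * m) := by exact_mod_cast hN2
  have n0 : (0 : ℝ) < n := by exact_mod_cast hn
  have m0 : (0 : ℝ) < m := by exact_mod_cast hm1
  have N0 : (0 : ℝ) < N := by exact_mod_cast hn.trans hN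
  have sN : 0 < Real.sqrt N := Real.sqrt_pos.2 N0
  have sm : 0 < Real.sqrt m := Real.sqrt_pos.2 m0
  have sL : 0 < Real.sqrt L := Real.sqrt_pos.2 hL0
  have hmax : 5000 * max M (g + S * Real.sqrt L) ≤ r * Real.sqrt N := by
    rwa [div_mul_eq_mul_div, div_le_iff₀ sN] at h
  have hM : 5000 * M ≤ r * Real.sqrt N := by
    linarith [le_max_left M (g + S * Real.sqrt L)]
  -- The term `g` is dropped, being nonnegative.
  have hSL : 5000 * (S * Real.sqrt L) ≤ r * Real.sqrt N := by
    linarith [le_max_right M (g + S * Real.sqrt L)]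
  have hsN : Real.sqrt N ≤ 5 / 2 * (Real.sqrt L * Real.sqrt m) := by
    rw [← Real.sqrt_mul hL0.le]
    refine Real.sqrt_le_iff.2 ⟨by positivity, ?_⟩
    rw [mul_pow, Real.sq_sqrt (by positivity)]
    have := mul_le_mul_of_nonneg_right hnL m0.le
    have : 0 < L * m := by positivity
    linarith
  have b1 : S / Real.sqrt m ≤ r / 2000 := by
    rw [div_le_iff₀ sm]
    have : 5000 * (S * Real.sqrt L) ≤ (r * (5 / 2 * Real.sqrt m)) * Real.sqrt L := by
      refine hSL.trans ((mul_le_mul_of_nonneg_left hsN hr.le).trans_eq (by ring))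
    have := le_of_mul_le_mul_right
      (show (5000 * S) * Real.sqrt L ≤ (r * (5 / 2 * Real.sqrt m)) * Real.sqrt L by linarith) sL
    linarith
  have b2 : (m : ℝ)⁻¹ * (2 * Real.sqrt N * M) ≤ 4 * n * r / 5000 := by
    rw [inv_mul_le_iff₀ m0]
    have h2 := mul_le_mul_of_nonneg_left hM sN.le
    have h3 : Real.sqrt N * (r * Real.sqrt N) = r * N := by
      have := Real.mul_self_sqrt N0.le
      linear_combination r * this
    have h4 := mul_le_mul_of_nonneg_left hN2' hr.le
    linarith
  -- The two contributions amount to 1/2000 + 16/5000 < 1/256 in units of nr; the constant 5000 is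
  -- chosen for this.
  rw [div_le_iff₀ hr]
  have b3 := mul_le_mul_of_nonneg_left b1 n0.le
  have : 0 < n * r := by positivity
  linarith

/-- The tail bound for finitely many directions. -/
lemma measureReal_map_half_le_maxCount_le {ι : Type*} [Fintype ι] [Nonempty ι]
    (hp : ∀ v, p v = 0 → v = 0) (h0 : 0 < δ) (h1 : δ < 1) (hN : numBlocks δ ≤ N)
    (hν : MemLp (fun x : Vec d => x) 2 ν) {r : ℝ} (hr : 0 < r)
    (h : 5000 / Real.sqrt N * max (rademacherMean p N ν) (gaussianMean p ν +
      weakStd p ν * Real.sqrt (Real.log (2 / δ))) ≤ r) (t : ι → Vec d)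
    (ht : ∀ i, t i ∈ dualBall p) :
    ((Measure.pi fun _ : Fin N => ν).map
      fun x (j : Fin (numBlocks δ)) => blockMean (numBlocks δ) x j - mean ν).real
      {z | (numBlocks δ : ℝ) / 2 ≤ maxCount t r z} ≤ 2 ^ 15 * δ := by
  have hn := one_le_numBlocks h0 h1
  have hm : 1 ≤ N / numBlocks δ := (Nat.one_le_div_iff hn).2 hN
  have harith := blocks_arith h0 h1 hN
    (integral_nonneg fun g => apply_nonneg p g : 0 ≤ gaussianMean p ν) hr h
  have hexp := exp_neg_numBlocks_le h0
  set n := numBlocks δ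
  set P : Measure (Fin N → Vec d) := Measure.pi fun _ => ν
  have mW : ∀ j : Fin n, Measurable fun x : Fin N → Vec d => blockMean n x j - mean ν :=
    fun j => measurable_blockMean_sub j _
  have hind := iIndepFun_blockMean_sub (n := n) (N := N) ν hm
  -- Independence of the blocks turns their joint law into a product measure, with one coordinate
  -- per block.
  have hmap := hind.map_fun_eq_pi_map fun j => (mW j).aemeasurable
  have hE := integral_maxOver_trunc_le (P := P) hp t ht _ mW
    (integrable_blockMean_sub ν hν hm) hind hr
    (A := n * (weakStd p ν / Real.sqrt ((N / n : ℕ) : ℝ))) (fun i => by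
      refine (Finset.sum_le_card_nsmul _ _ _ fun j _ =>
        integral_abs_inner_blockMean_le ν hν hm (ht i) j).trans_eq ?_
      simp) fun s => integral_seminorm_sum_blockMean_le ν p hν hm s
  have : ∀ j : Fin n, IsProbabilityMeasure (P.map fun x => blockMean n x j - mean ν) :=
    fun j => Measure.isProbabilityMeasure_map (mW j).aemeasurable
  have hcount := measureReal_half_le_maxCount_le hn
    (fun j : Fin n => P.map fun x => blockMean n x j - mean ν) t r ?_
  · rw [hmap]
    linarith
  · rw [← hmap, integral_map (measurable_pi_lambda _ mW).aemeasurable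
      (measurable_maxCount t r).aestronglyMeasurable]
    refine le_trans (integral_mono_of_nonneg (.of_forall fun x => maxCount_nonneg _ _ _) ?_
      (.of_forall fun x => maxCount_le_maxOver_trunc t hr _)) (hE.trans harith)
    have cΦ : Continuous fun z : Fin n → Vec d => maxOver fun i => ∑ j, trunc r ⟪t i, z j⟫ :=
      isSublinear_maxOver.continuous.comp (continuous_pi fun i => continuous_finsetSum _
        fun j _ => (continuous_trunc r).comp (by fun_prop))
    refine Integrable.of_bound (C := n)
      (cΦ.measurable.comp (measurable_pi_lambda _ mW)).aestronglyMeasurable (.of_forall fun x => ?_)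
    rw [Real.norm_eq_abs, abs_of_nonneg]
    · refine maxOver_le fun i => (Finset.sum_le_sum (g := fun _ => (1 : ℝ)) fun j _ =>
        min_le_right _ _).trans (by simp)
    · exact (Finset.sum_nonneg fun j _ => trunc_nonneg hr _).trans
        (le_maxOver (fun i => ∑ j, trunc r ⟪t i, blockMean n x j - mean ν⟫) (Classical.arbitrary ι))

lemma isOpen_setOf_half_le_ncard (n : ℕ) (t : Vec d) (r : ℝ) :
    IsOpen {z : Fin n → Vec d |
      (n : ℝ) / 2 ≤ (({j | r < |⟪t, z j⟫|} : Set (Fin n)).ncard : ℝ)} := by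
  classical
  rw [setOf_ncard_eq_biUnion (fun k => (n : ℝ) / 2 ≤ k)
    (fun a b hab h => h.trans (Nat.cast_le.2 hab)) fun j (z : Fin n → Vec d) => r < |⟪t, z j⟫|]
  exact isOpen_biUnion fun J _ => isOpen_biInter_finset fun j _ =>
    isOpen_lt continuous_const (by fun_prop)

/-- A union of open sets is small as soon as all its finite subunions are. -/
lemma measure_biUnion_le_of_forall_fin {α β : Type*} [TopologicalSpace α]
    [SecondCountableTopology α] [MeasurableSpace α] (μ : Measure α) (I : Set β) (s : β → Set α)
    (hs : ∀ i ∈ I, IsOpen (s i)) (K : ENNReal)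
    (h : ∀ (k : ℕ) (e : Fin (k + 1) → β), (∀ i, e i ∈ I) → μ (⋃ i, s (e i)) ≤ K) :
    μ (⋃ i ∈ I, s i) ≤ K := by
  obtain ⟨T, hTI, hT, hTU⟩ := TopologicalSpace.isOpen_biUnion_countable I s hs
  rw [← hTU]
  rcases T.eq_empty_or_nonempty with rfl | hne
  · simp
  obtain ⟨e, rfl⟩ := hT.exists_eq_range hne
  rw [Set.biUnion_range, measure_iUnion_eq_iSup_accumulate]
  refine iSup_le fun k => (measure_mono ?_).trans (h k (fun i => e i) fun i => hTI ⟨i, rfl⟩)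
  intro z hz
  obtain ⟨i, hi, hz⟩ := Set.mem_accumulate.1 hz
  exact Set.mem_iUnion.2 ⟨⟨i, Nat.lt_succ_of_le hi⟩, hz⟩

/-- The event on which some direction is badly estimated. -/
def badSet (p : Seminorm ℝ (Vec d)) (n : ℕ) (ε : ℝ) : Set (Fin n → Vec d) :=
  ⋃ a ∈ Set.extremePoints ℝ (dualBall p) ×ˢ Set.Ioi (ε / 2),
    {z | (n : ℝ) / 2 ≤ (({j | a.2 < |⟪a.1, z j⟫|} : Set (Fin n)).ncard : ℝ)}

lemma isOpen_badSet (p : Seminorm ℝ (Vec d)) (n : ℕ) (ε : ℝ) : IsOpen (badSet p n ε) :=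
  isOpen_biUnion fun a _ => isOpen_setOf_half_le_ncard n a.1 a.2

lemma measure_badSet_le (hp : ∀ v, p v = 0 → v = 0) (h0 : 0 < δ) (h1 : δ < 1)
    (hN : numBlocks δ ≤ N) (hν : MemLp (fun x : Vec d => x) 2 ν) {ε : ℝ} (hε : 0 ≤ ε)
    (h : 10000 / Real.sqrt N * max (rademacherMean p N ν) (gaussianMean p ν +
      weakStd p ν * Real.sqrt (Real.log (2 / δ))) ≤ ε) :
    ((Measure.pi fun _ : Fin N => ν).map
      fun x (j : Fin (numBlocks δ)) => blockMean (numBlocks δ) x j - mean ν)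
      (badSet p (numBlocks δ) ε) ≤ ENNReal.ofReal (2 ^ 15 * δ) := by
  have hpr := Measure.isProbabilityMeasure_map (μ := Measure.pi fun _ : Fin N => ν)
    (measurable_pi_lambda _ fun j : Fin (numBlocks δ) =>
      measurable_blockMean_sub (N := N) j (mean ν)).aemeasurable
  refine measure_biUnion_le_of_forall_fin _ _ _
    (fun a _ => isOpen_setOf_half_le_ncard _ a.1 a.2) _ fun k e he => ?_
  -- Lowering finitely many thresholds to the smallest one only enlarges the counts. It still
  -- exceeds `ε / 2`, hence is positive even if `ε` = 0, as truncation requires.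
  obtain ⟨i0, hi0⟩ := Finite.exists_min fun i => (e i).2
  have hr : ε / 2 < (e i0).2 := (he i0).2
  have hb := measureReal_map_half_le_maxCount_le ν hp h0 h1 hN hν
    (r := (e i0).2) (by linarith) (by
      refine le_trans (le_of_eq ?_) ((div_le_div_of_nonneg_right h zero_le_two).trans hr.le)
      ring) (fun i => (e i).1) fun i => extremePoints_subset (he i).1
  rw [← ofReal_measureReal]
  refine ENNReal.ofReal_le_ofReal ((measureReal_mono fun z hz => ?_).trans hb)
  obtain ⟨i, hi⟩ := Set.mem_iUnion.1 hz
  have hi : (numBlocks δ : ℝ) / 2 ≤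
    (({j | (e i).2 < |⟪(e i).1, z j⟫|} : Set (Fin (numBlocks δ))).ncard : ℝ) := hi
  refine hi.trans (le_trans ?_ (le_maxOver (fun i => ∑ j, if (e i0).2 < |⟪(e i).1, z j⟫| then
    (1 : ℝ) else 0) i))
  rw [Finset.sum_boole, Nat.cast_le, ← Set.ncard_coe_finset, Finset.coe_filter_univ]
  exact Set.ncard_le_ncard (fun j hj => (hi0 i).trans_lt hj) (Set.toFinite _)

lemma mem_feasible_of_notMem_badSet {μ : Vec d} {x : Fin N → Vec d} {ε s : ℝ}
    (hx : (fun j => blockMean (numBlocks δ) x j - μ) ∉ badSet p (numBlocks δ) ε)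
    (hs : ε / 2 < s) : μ ∈ feasible p δ x s := by
  refine Set.mem_iInter₂.2 fun t ht => ?_
  set n := numBlocks δ
  have h : ¬ (n : ℝ) / 2 ≤
      (({j | s < |⟪t, blockMean n x j - μ⟫|} : Set (Fin n)).ncard : ℝ) := fun h' =>
    hx (Set.mem_biUnion (show (t, s) ∈ _ ×ˢ _ from ⟨ht, hs⟩) h')
  have e : ({j | |⟪t, blockMean n x j⟫ - ⟪t, μ⟫| ≤ s} : Set (Fin n)) =
      {j | s < |⟪t, blockMean n x j - μ⟫|}ᶜ := by
    ext j; simp [inner_sub_right]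
  show (n : ℝ) / 2 < _
  have h2 := Set.ncard_add_ncard_compl ({j | s < |⟪t, blockMean n x j - μ⟫|} : Set (Fin n))
  rw [Nat.card_fin] at h2
  have h3 : (({j | s < |⟪t, blockMean n x j - μ⟫|} : Set (Fin n)).ncard : ℝ) +
    (({j | s < |⟪t, blockMean n x j - μ⟫|}ᶜ : Set (Fin n)).ncard : ℝ) = n := by exact_mod_cast h2
  rw [e]
  linarith

end Main

end NormMean

theorem mainTheorem2 :
    ∃ c c' : ℝ, 0 < c ∧ 0 < c' ∧
      ∀ (d : ℕ) (p : Seminorm ℝ (NormMean.Vec d)), (∀ v, p v = 0 → v = 0) →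
      ∀ δ : ℝ, 0 < δ → δ < 1 → ∀ N : ℕ, NormMean.numBlocks δ ≤ N →
        -- the estimator is well defined, for every sample
        (∀ x : Fin N → NormMean.Vec d,
          {ε : ℝ | 0 < ε ∧ (NormMean.feasible p δ x ε).Nonempty}.Nonempty ∧
          (∀ ε, NormMean.epsZero p δ x < ε →
            (NormMean.feasible p δ x ε).Nonempty ∧ IsCompact (NormMean.feasible p δ x ε)) ∧
          (∀ ε ε', NormMean.epsZero p δ x < ε → ε ≤ ε' →
            NormMean.feasible p δ x ε ⊆ NormMean.feasible p δ x ε') ∧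
          (NormMean.estimateSet p δ x).Nonempty) ∧
        -- its performance, whatever choice is made
        ∀ est : (Fin N → NormMean.Vec d) → NormMean.Vec d,
          (∀ x, est x ∈ NormMean.estimateSet p δ x) →
          ∀ (ν : Measure (NormMean.Vec d)) [IsProbabilityMeasure ν],
            MemLp (fun x : NormMean.Vec d => x) 2 ν →
          ∀ (Ω : Type*) [MeasurableSpace Ω] (P : Measure Ω) [IsProbabilityMeasure P]
            (X : Fin N → Ω → NormMean.Vec d),
            (∀ i, HasLaw (X i) ν P) → iIndepFun X P →
          ∀ ε : ℝ,
            c / Real.sqrt N *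
                max (NormMean.rademacherMean p N ν)
                  (NormMean.gaussianMean p ν +
                    NormMean.weakStd p ν * Real.sqrt (Real.log (2 / δ))) ≤ ε →
            ∃ A : Set Ω, MeasurableSet A ∧ 1 - c' * δ ≤ P.real A ∧
              ∀ ω ∈ A, p (est (fun i => X i ω) - NormMean.mean ν) ≤ ε := by
  
  -- 10000 is twice 5000, as the tail bound is used at levels above `ε / 2`; 2^15 is 2^16 halved by
  -- exp(-n) ≤ δ/2.
  refine ⟨10000, 2 ^ 15, by norm_num, by norm_num, fun d p hp δ h0 h1 N hN => ⟨fun x =>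
    ⟨NormMean.nonempty_setOf_feasible hp h0 h1, fun ε hε =>
      ⟨NormMean.feasible_nonempty hp h0 h1 hε, NormMean.isCompact_feasible hp ε⟩,
      fun ε ε' _ h => NormMean.feasible_mono h, NormMean.estimateSet_nonempty hp h0 h1⟩, ?_⟩⟩
  intro est hest ν _ hν Ω _ P _ X hX hind ε hε
  have hε0 : 0 ≤ ε := by
    refine le_trans (mul_nonneg (by positivity) (le_max_of_le_right ?_)) hε
    exact add_nonneg (integral_nonneg fun g => apply_nonneg p g)
      (mul_nonneg (NormMean.weakStd_nonneg ν p) (Real.sqrt_nonneg _))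
  set n := NormMean.numBlocks δ with hn
  have hlaw := hind.hasLaw_pi hX
  have mW : Measurable fun (x : Fin N → NormMean.Vec d) (j : Fin n) =>
      NormMean.blockMean n x j - NormMean.mean ν :=
    measurable_pi_lambda _ fun j => NormMean.measurable_blockMean_sub j _
  have hbad := NormMean.measure_badSet_le ν hp h0 h1 hN hν hε0 hε
  have mbad : MeasurableSet (NormMean.badSet p n ε) := (NormMean.isOpen_badSet p n ε).measurableSet
  set B := (fun (ω : Ω) (j : Fin n) =>
    NormMean.blockMean n (fun i => X i ω) j - NormMean.mean ν) ⁻¹' (NormMean.badSet p n ε) with hB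
  have hPB : P.real B ≤ 2 ^ 15 * δ := by
    refine ENNReal.toReal_le_of_le_ofReal (by positivity) (le_of_eq_of_le ?_ hbad)
    rw [Measure.map_apply mW mbad, ← hlaw.map_eq,
      Measure.map_apply_of_aemeasurable hlaw.aemeasurable (mW mbad)]
    rfl
  have nB : NullMeasurableSet B P :=
    (mW.comp_aemeasurable hlaw.aemeasurable).nullMeasurable mbad
  -- The choice `est` need not be measurable, so the event is found inside the complement of `B`,
  -- itself only null measurable because the `X i` are merely almost everywhere measurable.
  obtain ⟨A, hAB, hA, hAe⟩ := nB.compl.exists_measurable_subset_ae_eq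
  refine ⟨A, hA, ?_, fun ω hω => ?_⟩
  · rw [measureReal_congr hAe, probReal_compl_eq_one_sub₀ nB]
    linarith
  · have h := NormMean.seminorm_sub_le_of_mem_estimateSet (r := ε / 2) (by linarith)
      (hest fun i => X i ω) fun s hs => NormMean.mem_feasible_of_notMem_badSet (hAB hω) hs
    linarith
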